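/- **Setting.** Let $A$ and $B$ be primitive nonsingular square matrices with nonnegative integer entries, of sizes $m,n\ge 1$. (Primitive: some power has only strictly positive entries.) For such a matrix $A$ of size $N$, its ordered dimension group is $$G(A)=\bigcup_{k\ge 0}A^{-k}(\mathbb Z^N)\subseteq\mathbb Q^N,\qquad G(A)_+=\bigcup_{k\ge 0}A^{-k}(\mathbb Z_{\ge 0}^N).$$ An isomorphism of ordered dimension groups $G(A)\to G(B)$ is a group isomorphism carrying $G(A)_+$ onto $G(B)_+$. Let $\lambda,\lambda'$ be the Perron–Frobenius eigenvalues (spectral radii) of $A$ and $B$. Let $F\subset\mathbb C$ be the number field generated by all eigenvalues of $A$ and $B$, and let $E\subset\mathbb C$ be a finite extension of $F$ in which every ideal of $\mathcal O_F$ becomes principal. A *prime* of a number field means a nonzero prime ideal of its ring of integers. A *normalized* Perron–Frobenius row (column) eigenvector of $A$ is a row (column) eigenvector for $\lambda$ whose entries lie in $\mathcal O_E$ and have gcd $1$, i.e. generate the unit ideal of $\mathcal O_E$; similarly for $B$ and $\lambda'$. Write $\langle x,y\rangle=\sum_i x_iy_i$. **Proposition.** Let $\theta\colon G(A)\to G(B)$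 be an isomorphism of ordered dimension groups. Then normalized Perron–Frobenius row and column eigenvectors of $A$ and of $B$ exist, $m=n$, and $\theta$ is given by $\theta(g)=Jg$ for a matrix $J$ with rational entries. For all normalized Perron–Frobenius row eigenvectors $v$ of $A$, $v'$ of $B$ and column eigenvectors $w$ of $A$, $w'$ of $B$, the following hold. 1. $v'J=c\,v$ for some nonzero $c\in E$. 2. $\mathbb Q(\lambda)=\mathbb Q(\lambda')$, and $\lambda$ and $\lambda'$ are divisible by the same primes of this field. Assume in addition that for each eigenvalue $\mu\ne\lambda$ of $A$, and for each eigenvalue $\mu\neq\lambda'$ of $B$, there is a prime of $E$ that divides $\lambda$ but does not divide $\mu$. Then: 3. $Jw=\xi\,w'$ for some nonzero $\xi\in E$. 4. The principal fractional ideal $(\xi)$ of $E$ is a product of (positive or negative) integer powers of primes of $E$ dividing $\lambda$. 5. The same is true of $(c)$. The inner products satisfy $v'Jw=c\,\langle v,w\rangle=\xi\,\langle v',w'\rangle$, and also $v'Jw'=c\,\langle v,w'\rangle=(c/\xi)\,\langle v,Jw\rangle$. Therefore $\langle v,w\rangle=u\,\langle v',w'\rangle$ for some unit $u$ of the ring $\mathcal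 O_E[1/\lambda]$. -/

import Mathlib

open scoped NumberField nonZeroDivisors Matrix IntermediateField
open IsDedekindDomain

noncomputable section

/-- The dimension group `G(A) = ⋃ₙ A⁻ⁿ(ℤᴺ) ⊆ ℚᴺ` of a (nonsingular) integer matrix `A`:
a rational column vector lies in it iff some power of `A` makes it integral. -/
def dimensionGroup {N : ℕ} (A : Matrix (Fin N) (Fin N) ℤ) : AddSubgroup (Fin N → ℚ) where
  carrier := {g | ∃ k : ℕ, ∃ z : Fin N → ℤ,
    (A.map (Int.cast : ℤ → ℚ)) ^ k *ᵥ g = fun i => (z i : ℚ)}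
  zero_mem' := ⟨0, 0, by ext i; simp⟩
  neg_mem' := by
    rintro g ⟨k, z, h⟩
    refine ⟨k, -z, ?_⟩
    rw [Matrix.mulVec_neg, h]
    ext i
    simp
  add_mem' := by
    have key : ∀ (l : ℕ) (z : Fin N → ℤ),
        (A.map (Int.cast : ℤ → ℚ)) ^ l *ᵥ (fun i => (z i : ℚ))
          = fun i => (((A ^ l) *ᵥ z) i : ℚ) := by
      intro l z
      have hp : (A.map (Int.cast : ℤ → ℚ)) ^ l = (A ^ l).map (Int.cast : ℤ → ℚ) :=
        (Matrix.map_pow A (Int.castRingHom ℚ) l).symm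
      rw [hp]
      ext i
      simp [Matrix.mulVec, dotProduct]
    rintro g h ⟨k, y, hg⟩ ⟨l, z, hh⟩
    refine ⟨k + l, (A ^ l) *ᵥ y + (A ^ k) *ᵥ z, ?_⟩
    rw [Matrix.mulVec_add]
    nth_rewrite 1 [add_comm k l]
    rw [pow_add, pow_add, ← Matrix.mulVec_mulVec, ← Matrix.mulVec_mulVec, hg, hh, key, key]
    ext i
    simp

/-- The positive cone `G(A)₊ = ⋃ₙ A⁻ⁿ(ℤ₊ᴺ)` of the dimension group, where `ℤ₊ = {0, 1, 2, …}`. -/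
def dimensionGroupNonneg {N : ℕ} (A : Matrix (Fin N) (Fin N) ℤ) : Set (Fin N → ℚ) :=
  {g | ∃ k : ℕ, ∃ z : Fin N → ℕ, (A.map (Int.cast : ℤ → ℚ)) ^ k *ᵥ g = fun i => (z i : ℚ)}

/-- An isomorphism of ordered dimension groups: a group isomorphism that maps the positive cone
of the source onto the positive cone of the target. -/
structure OrderedDimensionGroupIso {m n : ℕ}
    (A : Matrix (Fin m) (Fin m) ℤ) (B : Matrix (Fin n) (Fin n) ℤ)
    extends dimensionGroup A ≃+ dimensionGroup B where
  nonneg_iff : ∀ g : dimensionGroup A,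
    (g : Fin m → ℚ) ∈ dimensionGroupNonneg A ↔
      (toFun g : Fin n → ℚ) ∈ dimensionGroupNonneg B

/-- The set of complex eigenvalues of an integer matrix. -/
def complexEigenvalues {N : ℕ} (A : Matrix (Fin N) (Fin N) ℤ) : Set ℂ :=
  spectrum ℂ (A.map (Int.cast : ℤ → ℂ))

/-- The Perron–Frobenius eigenvalue of a primitive matrix: its spectral radius, viewed as a
complex number. -/
def perronFrobenius {N : ℕ} (A : Matrix (Fin N) (Fin N) ℤ) : ℂ :=
  ((spectralRadius ℂ (A.map (Int.cast : ℤ → ℂ))).toReal : ℂ)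

/-- The number field `F ⊆ ℂ` generated by all the eigenvalues of `A` and `B`. -/
def eigenvalueField {m n : ℕ}
    (A : Matrix (Fin m) (Fin m) ℤ) (B : Matrix (Fin n) (Fin n) ℤ) : IntermediateField ℚ ℂ :=
  IntermediateField.adjoin ℚ (complexEigenvalues A ∪ complexEigenvalues B)

/-- All ideals of (the ring of integers of) `F` become principal in `E`. -/
def IdealsBecomePrincipal {F E : IntermediateField ℚ ℂ} (hFE : F ≤ E) : Prop :=
  ∀ I : Ideal (𝓞 F),
    (I.map (NumberField.RingOfIntegers.mapRingHom
      (IntermediateField.inclusion hFE).toRingHom)).IsPrincipal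

/-- The algebraic prime `p` (a nonzero prime ideal of the ring of integers of `K`) divides the
algebraic integer `z` of `K`. -/
def PrimeDivides {K : IntermediateField ℚ ℂ} (p : HeightOneSpectrum (𝓞 K)) (z : ℂ) : Prop :=
  ∃ a : 𝓞 K, algebraMap (𝓞 K) ℂ a = z ∧ p.asIdeal ∣ Ideal.span {a}

/-- The principal fractional ideal generated by `c ∈ E` is a product of integer powers
(positive or negative) of primes of `E` dividing `z`. -/
def FactorsIntoPrimesOf {E : IntermediateField ℚ ℂ} [NumberField E] (c : E) (z : ℂ) : Prop :=
  ∃ (S : Finset (HeightOneSpectrum (𝓞 E))) (k : HeightOneSpectrum (𝓞 E) → ℤ),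
    (∀ p ∈ S, PrimeDivides p z) ∧
      FractionalIdeal.spanSingleton (𝓞 E)⁰ c =
        ∏ p ∈ S, (p.asIdeal : FractionalIdeal (𝓞 E)⁰ E) ^ k p

/-- The complex vector with the given entries from the ring of integers of `E`. -/
def toComplex {E : IntermediateField ℚ ℂ} {N : ℕ} (v : Fin N → 𝓞 E) : Fin N → ℂ :=
  fun i => algebraMap (𝓞 E) ℂ (v i)

/-- `v` is a normalized Perron–Frobenius row eigenvector of `A`: all entries are algebraic
integers of `E`, their gcd is `1` (they generate the unit ideal), and `vA = λv`.
Vectors with gcd `1` are nonzero. -/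
def IsNormalizedRow {E : IntermediateField ℚ ℂ} {N : ℕ} (A : Matrix (Fin N) (Fin N) ℤ)
    (v : Fin N → 𝓞 E) : Prop :=
  Ideal.span (Set.range v) = ⊤ ∧
    toComplex v ᵥ* A.map (Int.cast : ℤ → ℂ) = perronFrobenius A • toComplex v

/-- `w` is a normalized Perron–Frobenius column eigenvector of `A`. -/
def IsNormalizedColumn {E : IntermediateField ℚ ℂ} {N : ℕ} (A : Matrix (Fin N) (Fin N) ℤ)
    (w : Fin N → 𝓞 E) : Prop :=
  Ideal.span (Set.range w) = ⊤ ∧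
    A.map (Int.cast : ℤ → ℂ) *ᵥ toComplex w = perronFrobenius A • toComplex w

/-- For each eigenvalue `μ` of `A` other than the Perron–Frobenius eigenvalue of `A`, some prime
of `E` divides `z` and does not divide `μ`. -/
def PrimesSeparate (E : IntermediateField ℚ ℂ) {N : ℕ} (A : Matrix (Fin N) (Fin N) ℤ)
    (z : ℂ) : Prop :=
  ∀ μ ∈ complexEigenvalues A, μ ≠ perronFrobenius A →
    ∃ p : HeightOneSpectrum (𝓞 E), PrimeDivides p z ∧ ¬ PrimeDivides p μ

end

/-! ### Perron–Frobenius theory for real primitive matrices. -/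

section PerronFrobenius

variable {ι : Type*} [Fintype ι]

/-! Write `λ`, `λ'` for the Perron–Frobenius eigenvalues of `A`, `B`. The isomorphism `θ` is a
rational matrix `J` with inverse `J'`, but `J` need not intertwine `A` with `B`, so eigenvectors are
not carried to eigenvectors for formal reasons. Rows are controlled by positivity, columns by
divisibility.

Rows: let `y` be a positive left eigenvector of `B`. Since `J` maps every `A⁻ᵏ(ℤ₊ᵐ)` into the
positive cone of `B`, all functionals `yJA⁻ᵏ` are nonnegative. A power of `A` contracts the rows
orthogonal to the right Perron–Frobenius vector relative to the Perron–Frobenius direction, so only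
multiples of the left Perron–Frobenius vector remain nonnegative under all backward iterates
(`Matrix.IsPrimitive.backward_orbit_unique`). Hence `v'J = c v`.

Field and primes: for every `k` there are `l` and an integer matrix `M` with `M Aᵏ = Bˡ J`.
Composing such a matrix with one for `J'` produces an integer matrix with eigenvalue `λ'ˡ/λ`, so `λ`
divides a power of `λ'`, and symmetrically. The rational matrix `J A J'` has a left eigenvector over
`ℚ(λ')` with eigenvalue `λ`, so `λ ∈ ℚ(λ')`.

Columns: `Bˡ J w = M Aᵏ w = λᵏ M w`, so `Jw` is divisible by every power of `λ`, up to powers of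
`B`. Eigenvectors for `μ ≠ λ'` cannot be, because of a prime dividing `λ` but not `μ`. Peeling off
the linear factors of the characteristic polynomial shows that `Jw` is a Perron–Frobenius vector
(`IsInfinitelyDivisible.mulVec_eq`).

Ideals: since the normalized vectors have gcd 1, the integral relations for `J` and `J'` make `c`,
`ξ` and their inverses integral after multiplication by powers of `λ`. They are therefore units of
`𝓞_E[1/λ]`. The inner product formulas evaluate `v'Jx` in two ways. -/

theorem exists_pos_mul_le (x y : ι → ℝ) (hy : ∀ i, 0 < y i) :
    ∃ ε > 0, ∀ i, ε * x i ≤ y i := by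
  rcases isEmpty_or_nonempty ι with h | h
  · exact ⟨1, one_pos, fun i => h.elim i⟩
  -- The `+ 1` keeps the denominator positive where `x` vanishes.
  obtain ⟨i₀, hi₀⟩ := Finite.exists_min fun i => y i / (|x i| + 1)
  have hpos : 0 < y i₀ / (|x i₀| + 1) := div_pos (hy i₀) (by positivity)
  refine ⟨_, hpos, fun i => ?_⟩
  calc y i₀ / (|x i₀| + 1) * x i ≤ y i₀ / (|x i₀| + 1) * (|x i| + 1) := by
        gcongr
        linarith [le_abs_self (x i)]
    _ ≤ y i / (|x i| + 1) * (|x i| + 1) :=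
        mul_le_mul_of_nonneg_right (hi₀ i) (by positivity)
    _ = y i := by field_simp

theorem mulVec_pos_of_pos {M : Matrix ι ι ℝ} (hM : ∀ i j, 0 < M i j) {x : ι → ℝ}
    (hx : 0 ≤ x) (hx₀ : x ≠ 0) (i : ι) : 0 < (M *ᵥ x) i := by
  obtain ⟨j, hj⟩ := Function.ne_iff.mp hx₀
  exact Finset.sum_pos' (fun k _ => mul_nonneg (hM i k).le (hx k))
    ⟨j, Finset.mem_univ _, mul_pos (hM i j) (lt_of_le_of_ne (hx j) (Ne.symm hj))⟩

theorem mulVec_nonneg_of_nonneg {M : Matrix ι ι ℝ} (hM : ∀ i j, 0 ≤ M i j) {x : ι → ℝ}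
    (hx : 0 ≤ x) : 0 ≤ M *ᵥ x :=
  fun i => Finset.sum_nonneg fun k _ => mul_nonneg (hM i k) (hx k)


/-- The eigenvalue of a positive left eigenvector of a nonnegative matrix bounds the modulus of
every eigenvalue. -/
theorem norm_le_of_pos_left_eigenvector {A : Matrix ι ι ℝ} (hA : ∀ i j, 0 ≤ A i j)
    {r : ℝ} {v : ι → ℝ} (hv : ∀ i, 0 < v i) (hAv : v ᵥ* A = r • v) {μ : ℂ} {z : ι → ℂ}
    (hz : z ≠ 0) (hAz : A.map (algebraMap ℝ ℂ) *ᵥ z = μ • z) : ‖μ‖ ≤ r := by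
  set y : ι → ℝ := fun i => ‖z i‖ with hy
  -- By the triangle inequality the moduli of `z` form a subeigenvector for `‖μ‖`; pairing with `v`
  -- compares `‖μ‖` with `r`.
  have hle : ∀ i, ‖μ‖ * y i ≤ (A *ᵥ y) i := fun i => by
    rw [hy, ← norm_mul, ← smul_eq_mul, ← Pi.smul_apply, ← hAz]
    refine (norm_sum_le _ _).trans_eq (Finset.sum_congr rfl fun j _ => ?_)
    simp [abs_of_nonneg (hA i j)]
  obtain ⟨j, hj⟩ := Function.ne_iff.mp hz
  have hpos : 0 < v ⬝ᵥ y := Finset.sum_pos' (fun i _ => mul_nonneg (hv i).le (norm_nonneg _))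
    ⟨j, Finset.mem_univ _, mul_pos (hv j) (norm_pos_iff.mpr hj)⟩
  refine le_of_mul_le_mul_right ?_ hpos
  calc ‖μ‖ * (v ⬝ᵥ y) = ∑ i, v i * (‖μ‖ * y i) := by
        simp only [dotProduct, Finset.mul_sum]
        exact Finset.sum_congr rfl fun i _ => by ring
    _ ≤ ∑ i, v i * (A *ᵥ y) i :=
        Finset.sum_le_sum fun i _ => mul_le_mul_of_nonneg_left (hle i) (hv i).le
    _ = r * (v ⬝ᵥ y) := by
        rw [← smul_eq_mul, ← smul_dotProduct, ← hAv, ← Matrix.dotProduct_mulVec]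
        rfl

/-- On the row vectors orthogonal to a positive right eigenvector for `r`, a positive matrix
contracts the weighted `ℓ¹`-norm by more than the factor `r`. -/
theorem exists_weighted_contraction [Nonempty ι] {M : Matrix ι ι ℝ} (hM : ∀ i j, 0 < M i j)
    {r : ℝ} {v w : ι → ℝ} (hv : ∀ i, 0 < v i) (hw : ∀ i, 0 < w i) (hMw : M *ᵥ w = r • w) :
    ∃ q : ℝ, 0 ≤ q ∧ q < r ∧ ∀ g : ι → ℝ, g ⬝ᵥ w = 0 →
      |g ᵥ* M| ⬝ᵥ w ≤ q * (|g| ⬝ᵥ w) := by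
  -- Choose `ε` with `M ≥ ε w vᵀ` entrywise. Subtracting this rank-one matrix keeps `M` nonnegative
  -- and does not change its action on rows orthogonal to `w`, but lowers the eigenvalue of `w` by
  -- `ε ⟨v, w⟩`.
  obtain ⟨ε, hε, hle⟩ := exists_pos_mul_le (fun p : ι × ι => w p.1 * v p.2)
    (fun p => M p.1 p.2) (fun p => hM p.1 p.2)
  have hvw : 0 < v ⬝ᵥ w :=
    Finset.sum_pos (fun i _ => mul_pos (hv i) (hw i)) Finset.univ_nonempty
  set Q : Matrix ι ι ℝ := M - ε • Matrix.vecMulVec w v with hQ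
  have hQnn : ∀ i j, 0 ≤ Q i j := fun i j => by
    simpa [hQ, Matrix.vecMulVec_apply] using hle (i, j)
  have hQw : Q *ᵥ w = (r - ε * (v ⬝ᵥ w)) • w := by
    rw [hQ, Matrix.sub_mulVec, Matrix.smul_mulVec, Matrix.vecMulVec_mulVec, hMw]
    ext i
    simp only [Pi.sub_apply, Pi.smul_apply, smul_eq_mul, MulOpposite.smul_eq_mul_unop,
      MulOpposite.unop_op]
    ring
  refine ⟨r - ε * (v ⬝ᵥ w), ?_, by nlinarith [mul_pos hε hvw], fun g hg => ?_⟩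
  · obtain ⟨i⟩ := ‹Nonempty ι›
    have := mulVec_nonneg_of_nonneg hQnn (fun i => (hw i).le) i
    rw [hQw] at this
    exact nonneg_of_mul_nonneg_left this (hw i)
  · have hgQ : g ᵥ* M = g ᵥ* Q := by
      rw [hQ, Matrix.vecMul_sub, Matrix.vecMul_smul, Matrix.vecMul_vecMulVec, hg]
      simp
    have habs : ∀ j, |(g ᵥ* Q) j| ≤ (|g| ᵥ* Q) j := fun j => by
      refine (Finset.abs_sum_le_sum_abs _ _).trans_eq (Finset.sum_congr rfl fun i _ => ?_)
      rw [abs_mul, abs_of_nonneg (hQnn i j), Pi.abs_apply]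
    calc |g ᵥ* M| ⬝ᵥ w ≤ (|g| ᵥ* Q) ⬝ᵥ w := by
          rw [hgQ]
          exact Finset.sum_le_sum fun j _ => mul_le_mul_of_nonneg_right (habs j) (hw j).le
      _ = _ := by rw [← Matrix.dotProduct_mulVec, hQw, dotProduct_smul, smul_eq_mul]

variable [DecidableEq ι]

theorem Matrix.IsPrimitive.transpose {A : Matrix ι ι ℝ} (hA : A.IsPrimitive) :
    Aᵀ.IsPrimitive := by
  obtain ⟨k, hk, hpos⟩ := hA.exists_pos_pow
  exact ⟨fun i j => hA.nonneg j i, k, hk, fun i j => by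
    rw [← Matrix.transpose_pow]; exact hpos j i⟩

theorem Matrix.pow_mulVec_eigenvector {R : Type*} [CommRing R] {A : Matrix ι ι R} {w : ι → R}
    {r : R} (h : A *ᵥ w = r • w) (k : ℕ) : A ^ k *ᵥ w = r ^ k • w := by
  induction k with
  | zero => simp
  | succ k ih => rw [pow_succ, ← Matrix.mulVec_mulVec, h, Matrix.mulVec_smul, ih, smul_smul,
      pow_succ, mul_comm]

theorem Matrix.vecMul_pow_eigenvector {R : Type*} [CommRing R] {A : Matrix ι ι R} {v : ι → R}
    {r : R} (h : v ᵥ* A = r • v) (k : ℕ) : v ᵥ* A ^ k = r ^ k • v := by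
  rw [← Matrix.mulVec_transpose] at h ⊢
  rw [Matrix.transpose_pow, Matrix.pow_mulVec_eigenvector h]

/-- A primitive real matrix has a positive eigenvector (Collatz–Wielandt). -/
theorem Matrix.IsPrimitive.exists_pos_eigenvector [Nonempty ι] {A : Matrix ι ι ℝ}
    (hA : A.IsPrimitive) :
    ∃ r : ℝ, 0 < r ∧ ∃ w : ι → ℝ, (∀ i, 0 < w i) ∧ A *ᵥ w = r • w := by
  obtain ⟨N, hN, hpos⟩ := hA.exists_pos_pow
  have hnn := hA.nonneg
  -- Pairs `(x, t)` with `x` in the simplex and `t x ≤ A x`; the eigenvalue is the largest such `t`,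
  -- attained by compactness.
  let K : Set ((ι → ℝ) × ℝ) := {p | p.1 ∈ stdSimplex ℝ ι ∧ 0 ≤ p.2 ∧
    ∀ i, p.2 * p.1 i ≤ (A *ᵥ p.1) i}
  have hKsub : K ⊆ stdSimplex ℝ ι ×ˢ Set.Icc 0 (∑ i, ∑ j, A i j) := by
    rintro ⟨x, t⟩ ⟨hx, ht, h⟩
    refine ⟨hx, ht, ?_⟩
    have hx1 : ∀ j, x j ≤ 1 := fun j => by
      rw [← hx.2]
      exact Finset.single_le_sum (fun i _ => hx.1 i) (Finset.mem_univ j)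
    calc t = ∑ i, t * x i := by rw [← Finset.mul_sum, hx.2, mul_one]
      _ ≤ ∑ i, (A *ᵥ x) i := Finset.sum_le_sum fun i _ => h i
      _ ≤ ∑ i, ∑ j, A i j := Finset.sum_le_sum fun i _ => Finset.sum_le_sum fun j _ =>
          mul_le_of_le_one_right (hnn i j) (hx1 j)
  have hKclosed : IsClosed K := by
    have h1 : IsClosed {p : (ι → ℝ) × ℝ | p.1 ∈ stdSimplex ℝ ι} :=
      (isClosed_stdSimplex ℝ ι).preimage continuous_fst
    have h2 : IsClosed {p : (ι → ℝ) × ℝ | 0 ≤ p.2} :=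
      isClosed_le continuous_const continuous_snd
    have h3 : IsClosed {p : (ι → ℝ) × ℝ | ∀ i, p.2 * p.1 i ≤ (A *ᵥ p.1) i} := by
      rw [Set.ofPred_forall]
      refine isClosed_iInter fun i => isClosed_le (by fun_prop) ?_
      simp only [Matrix.mulVec, dotProduct]
      fun_prop
    exact h1.inter (h2.inter h3)
  have hK : IsCompact K :=
    ((isCompact_stdSimplex ℝ ι).prod isCompact_Icc).of_isClosed_subset hKclosed hKsub
  have hKne : K.Nonempty := by
    obtain ⟨i⟩ := ‹Nonempty ι›
    refine ⟨(Pi.single i 1, 0), single_mem_stdSimplex ℝ i, le_rfl, fun j => ?_⟩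
    simpa using hnn j i
  obtain ⟨⟨x, r⟩, ⟨hx, hr, hxr⟩, hmax⟩ := hK.exists_isMaxOn hKne continuous_snd.continuousOn
  dsimp only at hx hr hxr
  have hx₀ : x ≠ 0 := by
    rintro rfl
    simpa using hx.2
  have hypos := mulVec_pos_of_pos hpos hx.1 hx₀
  -- Otherwise `A ^ N` turns the nonzero slack `A x - r x ≥ 0` into a strictly positive one for `y =
  -- A ^ N x`, leaving room to replace `r` by `r + ε`.
  have heig : A *ᵥ x = r • x := by
    by_contra hne
    have hd := mulVec_pos_of_pos hpos (x := A *ᵥ x - r • x)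
      (fun i => sub_nonneg.mpr (hxr i)) (sub_ne_zero.mpr hne)
    set y := A ^ N *ᵥ x with hy
    have hd' : ∀ i, 0 < (A *ᵥ y) i - r * y i := by
      intro i
      have := hd i
      rwa [Matrix.mulVec_sub, Matrix.mulVec_smul, Matrix.mulVec_mulVec, ← pow_succ, pow_succ',
        ← Matrix.mulVec_mulVec] at this
    obtain ⟨ε, hε, hle⟩ := exists_pos_mul_le y _ hd'
    have hs : 0 < ∑ i, y i := Finset.sum_pos (fun i _ => hypos i) Finset.univ_nonempty
    have hmem : ((∑ i, y i)⁻¹ • y, r + ε) ∈ K := by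
      refine ⟨⟨fun i => mul_nonneg (inv_nonneg.mpr hs.le) (hypos i).le, ?_⟩, by positivity,
        fun i => ?_⟩
      · simp only [Pi.smul_apply, smul_eq_mul]
        rw [← Finset.mul_sum, inv_mul_cancel₀ hs.ne']
      · dsimp only
        rw [Matrix.mulVec_smul, Pi.smul_apply, Pi.smul_apply, smul_eq_mul, smul_eq_mul,
          mul_left_comm]
        exact mul_le_mul_of_nonneg_left (by linarith [hle i]) (inv_nonneg.mpr hs.le)
    have := hmax hmem
    simp only [Set.mem_ofPred_eq] at this
    linarith
  have hpw := Matrix.pow_mulVec_eigenvector heig N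
  have hxpos : ∀ i, 0 < r ^ N * x i := fun i => by
    have := hypos i
    rwa [hpw] at this
  refine ⟨r, lt_of_le_of_ne hr ?_, x, fun i => ?_, heig⟩
  · rintro rfl
    obtain ⟨i⟩ := ‹Nonempty ι›
    simpa [hN.ne'] using hxpos i
  · exact pos_of_mul_pos_right (hxpos i) (pow_nonneg hr N)

/-- Left and right positive eigenvectors of a primitive real matrix, for the same eigenvalue. -/
theorem Matrix.IsPrimitive.exists_pos_eigenvectors [Nonempty ι] {A : Matrix ι ι ℝ}
    (hA : A.IsPrimitive) :
    ∃ (r : ℝ) (v w : ι → ℝ), 0 < r ∧ (∀ i, 0 < v i) ∧ (∀ i, 0 < w i) ∧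
      v ᵥ* A = r • v ∧ A *ᵥ w = r • w := by
  obtain ⟨r, hr, w, hw, hAw⟩ := hA.exists_pos_eigenvector
  obtain ⟨s, hs, v, hv, hAv⟩ := hA.transpose.exists_pos_eigenvector
  rw [Matrix.mulVec_transpose] at hAv
  -- Evaluating `v A w` in two ways identifies the left and right eigenvalues.
  have hvw : 0 < v ⬝ᵥ w :=
    Finset.sum_pos (fun i _ => mul_pos (hv i) (hw i)) Finset.univ_nonempty
  have h : s * (v ⬝ᵥ w) = r * (v ⬝ᵥ w) := by
    rw [← smul_eq_mul, ← smul_dotProduct, ← hAv, ← Matrix.dotProduct_mulVec, hAw,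
      dotProduct_smul, smul_eq_mul]
  obtain rfl := mul_right_cancel₀ hvw.ne' h
  exact ⟨s, v, w, hr, hv, hw, hAv, hAw⟩

/-- The eigenspace of a positive eigenvector of a primitive matrix is a line. -/
theorem Matrix.IsPrimitive.eigenvector_unique [Nonempty ι] {A : Matrix ι ι ℝ}
    (hA : A.IsPrimitive) {r : ℝ} {w x : ι → ℝ} (hw : ∀ i, 0 < w i) (hAw : A *ᵥ w = r • w)
    (hAx : A *ᵥ x = r • x) : ∃ t : ℝ, x = t • w := by
  obtain ⟨N, hN, hpos⟩ := hA.exists_pos_pow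
  -- With `t` the largest ratio, `t w - x` is a nonnegative eigenvector vanishing at `i₀`; were it
  -- nonzero, `A ^ N` would make that entry positive.
  obtain ⟨i₀, hi₀⟩ := Finite.exists_max fun i => x i / w i
  refine ⟨x i₀ / w i₀, ?_⟩
  by_contra hne
  set t := x i₀ / w i₀ with ht
  have hd : A *ᵥ (t • w - x) = r • (t • w - x) := by
    rw [Matrix.mulVec_sub, Matrix.mulVec_smul, hAw, hAx, smul_sub, smul_comm]
  have hle : 0 ≤ t • w - x := fun i => by
    have := (div_le_iff₀ (hw i)).mp (hi₀ i)
    simpa using this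
  have := mulVec_pos_of_pos hpos hle (sub_ne_zero.mpr (Ne.symm hne)) i₀
  rw [Matrix.pow_mulVec_eigenvector hd] at this
  have h0 : (t • w - x) i₀ = 0 := by
    simp [ht, (hw i₀).ne']
  simp only [Pi.smul_apply, h0, smul_zero, lt_irrefl] at this

theorem Matrix.IsPrimitive.complex_eigenvector_unique [Nonempty ι] {A : Matrix ι ι ℝ}
    (hA : A.IsPrimitive) {r : ℝ} {w : ι → ℝ} (hw : ∀ i, 0 < w i) (hAw : A *ᵥ w = r • w)
    {x : ι → ℂ} (hAx : A.map (algebraMap ℝ ℂ) *ᵥ x = (r : ℂ) • x) :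
    ∃ t : ℂ, x = t • fun i => (w i : ℂ) := by
  have hre : A *ᵥ (fun i => (x i).re) = r • fun i => (x i).re := by
    ext i
    simpa [Matrix.mulVec, dotProduct] using congrArg Complex.re (congrFun hAx i)
  have him : A *ᵥ (fun i => (x i).im) = r • fun i => (x i).im := by
    ext i
    simpa [Matrix.mulVec, dotProduct] using congrArg Complex.im (congrFun hAx i)
  obtain ⟨a, ha⟩ := hA.eigenvector_unique hw hAw hre
  obtain ⟨b, hb⟩ := hA.eigenvector_unique hw hAw him
  refine ⟨⟨a, b⟩, ?_⟩
  ext i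
  apply Complex.ext
  · simpa using congrFun ha i
  · simpa using congrFun hb i

/-- A nonnegative functional that stays nonnegative under all backward iterates of a primitive
matrix is a multiple of the positive left eigenvector. -/
theorem Matrix.IsPrimitive.backward_orbit_unique [Nonempty ι] {A : Matrix ι ι ℝ}
    (hA : A.IsPrimitive) {r : ℝ} (hr : 0 < r) {v w : ι → ℝ} (hv : ∀ i, 0 < v i)
    (hw : ∀ i, 0 < w i) (hAv : v ᵥ* A = r • v) (hAw : A *ᵥ w = r • w) (f : ℕ → ι → ℝ)
    (hf : ∀ k, 0 ≤ f k) (hstep : ∀ k l, f (k + l) ᵥ* A ^ l = f k) :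
    ∃ t : ℝ, f 0 = t • v := by
  obtain ⟨N, hN, hpos⟩ := hA.exists_pos_pow
  have hvw : 0 < v ⬝ᵥ w :=
    Finset.sum_pos (fun i _ => mul_pos (hv i) (hw i)) Finset.univ_nonempty
  have hrk : ∀ k : ℕ, 0 < r ^ k := fun k => pow_pos hr k
  obtain ⟨q, hq, hqr, hcontr⟩ :=
    exists_weighted_contraction hpos hv hw (Matrix.pow_mulVec_eigenvector hAw N)
  have hfw : ∀ k, f k ⬝ᵥ w = (f 0 ⬝ᵥ w) / r ^ k := fun k => by
    have := hstep 0 k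
    rw [zero_add] at this
    rw [← this, ← Matrix.dotProduct_mulVec, Matrix.pow_mulVec_eigenvector hAw,
      dotProduct_smul, smul_eq_mul, mul_div_cancel_left₀ _ (hrk k).ne']
  set t := (f 0 ⬝ᵥ w) / (v ⬝ᵥ w) with ht
  -- Subtracting the backward orbit of `t v` leaves a backward orbit orthogonal to `w`, to which the
  -- contraction applies.
  set g : ℕ → ι → ℝ := fun k => f k - (t / r ^ k) • v with hg
  have hgstep : ∀ k l, g (k + l) ᵥ* A ^ l = g k := fun k l => by
    simp only [hg]
    rw [Matrix.sub_vecMul, Matrix.smul_vecMul, hstep, Matrix.vecMul_pow_eigenvector hAv,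
      smul_smul, pow_add]
    congr 2
    have := (hrk k).ne'
    have := (hrk l).ne'
    field_simp
  have hgw : ∀ k, g k ⬝ᵥ w = 0 := fun k => by
    simp only [hg]
    rw [sub_dotProduct, smul_dotProduct, hfw, ht, smul_eq_mul]
    have := (hrk k).ne'
    field_simp
    ring
  set C := f 0 ⬝ᵥ w + |t| * (v ⬝ᵥ w) with hC
  have hbound : ∀ k, |g k| ⬝ᵥ w ≤ C / r ^ k := fun k => by
    have h1 : ∀ i, |g k| i ≤ f k i + |t| / r ^ k * v i := fun i => by
      simp only [hg, Pi.abs_apply, Pi.sub_apply, Pi.smul_apply, smul_eq_mul]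
      refine (abs_sub _ _).trans (le_of_eq ?_)
      rw [abs_of_nonneg (hf k i), abs_mul, abs_div, abs_of_pos (hrk k), abs_of_pos (hv i)]
    calc |g k| ⬝ᵥ w ≤ (f k + (|t| / r ^ k) • v) ⬝ᵥ w :=
          Finset.sum_le_sum fun i _ => mul_le_mul_of_nonneg_right (h1 i) (hw i).le
      _ = C / r ^ k := by
          rw [add_dotProduct, smul_dotProduct, hfw, hC, smul_eq_mul]
          ring
  -- Going from index `k * N` to `0` gains `q ^ k`, while the norm at index `k * N` is only `O(r ^
  -- (-k * N))`. As `q < r ^ N`, the norm of `g 0` is zero.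
  have hiter : ∀ k, |g 0| ⬝ᵥ w ≤ q ^ k * (|g (k * N)| ⬝ᵥ w) := fun k => by
    induction k with
    | zero => simp
    | succ k ih =>
      refine ih.trans ?_
      have := hcontr (g (k * N + N)) (hgw _)
      rw [hgstep] at this
      rw [Nat.succ_mul, pow_succ, mul_assoc]
      exact mul_le_mul_of_nonneg_left this (pow_nonneg hq k)
  have hdecay : ∀ k : ℕ, |g 0| ⬝ᵥ w ≤ C * (q / r ^ N) ^ k := fun k => by
    refine (hiter k).trans ((mul_le_mul_of_nonneg_left (hbound _) (pow_nonneg hq k)).trans_eq ?_)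
    rw [div_pow, ← pow_mul, mul_comm N k]
    ring
  have hlim : Filter.Tendsto (fun k : ℕ => C * (q / r ^ N) ^ k) Filter.atTop (nhds (C * 0)) :=
    (tendsto_pow_atTop_nhds_zero_of_lt_one (div_nonneg hq (hrk N).le)
      ((div_lt_one (hrk N)).mpr hqr)).const_mul C
  rw [mul_zero] at hlim
  have hzero := ge_of_tendsto' hlim hdecay
  refine ⟨t, funext fun i => ?_⟩
  have hterm := (Finset.sum_eq_zero_iff_of_nonneg fun i _ =>
    mul_nonneg (abs_nonneg (g 0 i)) (hw i).le).mp (le_antisymm hzero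
      (Finset.sum_nonneg fun i _ => mul_nonneg (abs_nonneg (g 0 i)) (hw i).le)) i
      (Finset.mem_univ i)
  have := abs_eq_zero.mp ((mul_eq_zero.mp hterm).resolve_right (hw i).ne')
  simpa [hg, sub_eq_zero] using this

end PerronFrobenius

/-! ### Base change of integer and rational matrices. -/

section Casts

variable {l m n : ℕ} (K : Type*) [Field K]

theorem intCast_map_mul (M : Matrix (Fin l) (Fin m) ℤ) (N : Matrix (Fin m) (Fin n) ℤ) :
    (M * N).map (Int.cast : ℤ → K) = M.map (Int.cast : ℤ → K) * N.map (Int.cast : ℤ → K) :=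
  Matrix.map_mul (f := Int.castRingHom K)

theorem intCast_map_pow (M : Matrix (Fin m) (Fin m) ℤ) (k : ℕ) :
    (M ^ k).map (Int.cast : ℤ → K) = M.map (Int.cast : ℤ → K) ^ k :=
  Matrix.map_pow M (Int.castRingHom K) k

theorem det_intCast_map (M : Matrix (Fin m) (Fin m) ℤ) :
    (M.map (Int.cast : ℤ → K)).det = (M.det : K) :=
  ((Int.castRingHom K).map_det M).symm

theorem isUnit_intCast_map [CharZero K] {M : Matrix (Fin m) (Fin m) ℤ} (hM : M.det ≠ 0) :
    IsUnit (M.map (Int.cast : ℤ → K)) := by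
  rw [Matrix.isUnit_iff_isUnit_det, det_intCast_map, isUnit_iff_ne_zero]
  exact_mod_cast hM

theorem ratCast_map_one : (1 : Matrix (Fin m) (Fin m) ℚ).map (Rat.cast : ℚ → K) = 1 :=
  Matrix.map_one _ Rat.cast_zero Rat.cast_one

theorem ratCast_map_intCast (M : Matrix (Fin l) (Fin m) ℤ) :
    (M.map (Int.cast : ℤ → ℚ)).map (Rat.cast : ℚ → K) = M.map (Int.cast : ℤ → K) := by
  ext i j
  simp

variable [CharZero K]

theorem ratCast_map_mul (M : Matrix (Fin l) (Fin m) ℚ) (N : Matrix (Fin m) (Fin n) ℚ) :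
    (M * N).map (Rat.cast : ℚ → K) = M.map (Rat.cast : ℚ → K) * N.map (Rat.cast : ℚ → K) :=
  Matrix.map_mul (f := Rat.castHom K)

theorem ratCast_map_pow (M : Matrix (Fin m) (Fin m) ℚ) (k : ℕ) :
    (M ^ k).map (Rat.cast : ℚ → K) = M.map (Rat.cast : ℚ → K) ^ k :=
  Matrix.map_pow M (Rat.castHom K) k

end Casts

/-! ### Spectrum and eigenvectors over a field. -/

section Eigenvectors

variable {ι : Type*} [Fintype ι] [DecidableEq ι]

theorem Matrix.mem_spectrum_iff_exists_mulVec {K : Type*} [Field K] {M : Matrix ι ι K} {μ : K} :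
    μ ∈ spectrum K M ↔ ∃ z ≠ 0, M *ᵥ z = μ • z := by
  rw [spectrum.mem_iff, Matrix.isUnit_iff_isUnit_det, isUnit_iff_ne_zero, not_not,
    ← Matrix.exists_mulVec_eq_zero_iff]
  refine exists_congr fun z => and_congr_right fun _ => ?_
  rw [Matrix.sub_mulVec, sub_eq_zero, eq_comm, Algebra.algebraMap_eq_smul_one,
    Matrix.smul_mulVec, Matrix.one_mulVec]

theorem Matrix.spectrum_transpose {K : Type*} [Field K] (M : Matrix ι ι K) :
    spectrum K Mᵀ = spectrum K M := by
  ext μ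
  rw [Matrix.mem_spectrum_iff_isRoot_charpoly, Matrix.mem_spectrum_iff_isRoot_charpoly,
    Matrix.charpoly_transpose]

end Eigenvectors

/-! ### Eigenvalues and Perron–Frobenius vectors of integer matrices. -/

section IntegerMatrices

variable {N : ℕ} {A : Matrix (Fin N) (Fin N) ℤ}

theorem intCast_transpose_map (K : Type*) [Field K] (A : Matrix (Fin N) (Fin N) ℤ) :
    Aᵀ.map (Int.cast : ℤ → K) = (A.map (Int.cast : ℤ → K))ᵀ := rfl

theorem mem_complexEigenvalues_iff {μ : ℂ} :
    μ ∈ complexEigenvalues A ↔ ∃ z ≠ 0, A.map (Int.cast : ℤ → ℂ) *ᵥ z = μ • z :=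
  Matrix.mem_spectrum_iff_exists_mulVec

theorem complexEigenvalues_transpose : complexEigenvalues Aᵀ = complexEigenvalues A :=
  Matrix.spectrum_transpose _

theorem perronFrobenius_transpose : perronFrobenius Aᵀ = perronFrobenius A := by
  have h : spectralRadius ℂ (Aᵀ.map (Int.cast : ℤ → ℂ)) =
      spectralRadius ℂ (A.map (Int.cast : ℤ → ℂ)) := by
    unfold spectralRadius
    rw [intCast_transpose_map, Matrix.spectrum_transpose]
  rw [perronFrobenius, h, perronFrobenius]

theorem isIntegral_of_mem_complexEigenvalues {μ : ℂ} (hμ : μ ∈ complexEigenvalues A) :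
    IsIntegral ℤ μ := by
  refine ⟨A.charpoly, A.charpoly_monic, ?_⟩
  have h := Matrix.mem_spectrum_iff_isRoot_charpoly.mp hμ
  rw [Polynomial.IsRoot, show A.map (Int.cast : ℤ → ℂ) = A.map (Int.castRingHom ℂ) from rfl,
    Matrix.charpoly_map, Polynomial.eval_map] at h
  exact h

theorem isIntegral_of_vecMul_eq_smul {μ : ℂ} {x : Fin N → ℂ} (hx : x ≠ 0)
    (h : x ᵥ* A.map (Int.cast : ℤ → ℂ) = μ • x) : IsIntegral ℤ μ := by
  rw [← Matrix.mulVec_transpose, ← intCast_transpose_map] at h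
  exact isIntegral_of_mem_complexEigenvalues (mem_complexEigenvalues_iff.mpr ⟨x, hx, h⟩)

theorem ne_zero_of_mem_complexEigenvalues (hA : A.det ≠ 0) {μ : ℂ}
    (hμ : μ ∈ complexEigenvalues A) : μ ≠ 0 := by
  rintro rfl
  exact spectrum.zero_notMem ℂ (isUnit_intCast_map ℂ hA) hμ

/-- An eigenvalue in a subfield has an eigenvector with entries in that subfield. -/
theorem exists_eigenvector_mem {K : IntermediateField ℚ ℂ} {μ : ℂ} (hμK : μ ∈ K)
    (hμ : μ ∈ complexEigenvalues A) :
    ∃ x : Fin N → ℂ, x ≠ 0 ∧ (∀ i, x i ∈ K) ∧ A.map (Int.cast : ℤ → ℂ) *ᵥ x = μ • x := by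
  have hroot : (⟨μ, hμK⟩ : K) ∈ spectrum K (A.map (Int.cast : ℤ → K)) := by
    rw [Matrix.mem_spectrum_iff_isRoot_charpoly,
      ← Polynomial.isRoot_map_iff (f := algebraMap K ℂ) (algebraMap K ℂ).injective,
      ← Matrix.charpoly_map]
    have := Matrix.mem_spectrum_iff_isRoot_charpoly.mp hμ
    have hmap : (A.map (Int.cast : ℤ → K)).map (algebraMap K ℂ) = A.map (Int.cast : ℤ → ℂ) := by
      ext i j
      simp
    rw [hmap]
    exact this
  obtain ⟨z, hz, h⟩ := Matrix.mem_spectrum_iff_exists_mulVec.mp hroot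
  refine ⟨fun i => z i, fun h0 => hz (funext fun i => ?_), fun i => (z i).2, ?_⟩
  · simpa using congrFun h0 i
  · ext i
    simpa [Matrix.mulVec, dotProduct] using congrArg (algebraMap K ℂ) (congrFun h i)

theorem exists_row_eigenvector_mem {K : IntermediateField ℚ ℂ} {μ : ℂ} (hμK : μ ∈ K)
    (hμ : μ ∈ complexEigenvalues A) :
    ∃ x : Fin N → ℂ, x ≠ 0 ∧ (∀ i, x i ∈ K) ∧ x ᵥ* A.map (Int.cast : ℤ → ℂ) = μ • x := by
  rw [← complexEigenvalues_transpose] at hμ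
  obtain ⟨x, h0, hx, h⟩ := exists_eigenvector_mem hμK hμ
  exact ⟨x, h0, hx, by rwa [intCast_transpose_map, Matrix.mulVec_transpose] at h⟩

theorem Matrix.IsPrimitive.intCast_map (hA : A.IsPrimitive) :
    (A.map (Int.cast : ℤ → ℝ)).IsPrimitive := by
  obtain ⟨k, hk, hpos⟩ := hA.exists_pos_pow
  refine ⟨fun i j => by simpa using hA.nonneg i j, k, hk, fun i j => ?_⟩
  rw [← intCast_map_pow]
  simpa using hpos i j

theorem Matrix.IsPrimitive.int_transpose (hA : A.IsPrimitive) : Aᵀ.IsPrimitive := by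
  obtain ⟨k, hk, hpos⟩ := hA.exists_pos_pow
  exact ⟨fun i j => hA.nonneg j i, k, hk, fun i j => by
    rw [← Matrix.transpose_pow]; exact hpos j i⟩

theorem intCast_map_complex (A : Matrix (Fin N) (Fin N) ℤ) :
    (A.map (Int.cast : ℤ → ℝ)).map (algebraMap ℝ ℂ) = A.map (Int.cast : ℤ → ℂ) := by
  ext i j
  simp

/-- The Perron–Frobenius theorem for the spectral radius of a primitive integer matrix. -/
theorem exists_perron_eigenvectors (hN : 0 < N) (hA : A.IsPrimitive) :
    ∃ (r : ℝ) (v w : Fin N → ℝ), 0 < r ∧ (∀ i, 0 < v i) ∧ (∀ i, 0 < w i) ∧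
      v ᵥ* A.map (Int.cast : ℤ → ℝ) = r • v ∧ A.map (Int.cast : ℤ → ℝ) *ᵥ w = r • w ∧
      perronFrobenius A = r := by
  have : Nonempty (Fin N) := ⟨⟨0, hN⟩⟩
  obtain ⟨r, v, w, hr, hv, hw, hAv, hAw⟩ := hA.intCast_map.exists_pos_eigenvectors
  refine ⟨r, v, w, hr, hv, hw, hAv, hAw, ?_⟩
  have hrad : spectralRadius ℂ (A.map (Int.cast : ℤ → ℂ)) = ENNReal.ofReal r := by
    -- The positive left eigenvector bounds all eigenvalues by `r`, and `r` is itself an eigenvalue.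
    refine le_antisymm (iSup₂_le fun μ hμ => ?_) ?_
    · obtain ⟨z, hz, h⟩ := mem_complexEigenvalues_iff.mp hμ
      rw [← intCast_map_complex] at h
      have := norm_le_of_pos_left_eigenvector hA.intCast_map.nonneg hv hAv hz h
      rw [← enorm_eq_nnnorm, ← ofReal_norm]
      exact ENNReal.ofReal_le_ofReal this
    · have hmem : (r : ℂ) ∈ complexEigenvalues A := by
        refine mem_complexEigenvalues_iff.mpr ⟨fun i => (w i : ℂ), fun h0 => ?_, ?_⟩
        · have := congrFun h0 ⟨0, hN⟩
          simp [(hw _).ne'] at this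
        · ext i
          simpa [Matrix.mulVec, dotProduct] using congrArg (Complex.ofReal) (congrFun hAw i)
      refine le_trans (le_of_eq ?_) (le_iSup₂ (f := fun (k : ℂ) (_ : k ∈ _) => (‖k‖₊ : ENNReal)) _ hmem)
      rw [← enorm_eq_nnnorm, ← ofReal_norm, Complex.norm_real, Real.norm_of_nonneg hr.le]
  rw [perronFrobenius, hrad, ENNReal.toReal_ofReal hr.le]

theorem perronFrobenius_ne_zero (hN : 0 < N) (hA : A.IsPrimitive) : perronFrobenius A ≠ 0 := by
  obtain ⟨r, v, w, hr, -, -, -, -, h⟩ := exists_perron_eigenvectors hN hA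
  rw [h]
  exact_mod_cast hr.ne'

theorem perron_column_unique (hN : 0 < N) (hA : A.IsPrimitive) {x y : Fin N → ℂ}
    (hx : A.map (Int.cast : ℤ → ℂ) *ᵥ x = perronFrobenius A • x)
    (hy : A.map (Int.cast : ℤ → ℂ) *ᵥ y = perronFrobenius A • y) (hy₀ : y ≠ 0) :
    ∃ t : ℂ, x = t • y := by
  have : Nonempty (Fin N) := ⟨⟨0, hN⟩⟩
  obtain ⟨r, v, w, hr, hv, hw, hAv, hAw, h⟩ := exists_perron_eigenvectors hN hA
  rw [h, ← intCast_map_complex] at hx hy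
  obtain ⟨a, rfl⟩ := hA.intCast_map.complex_eigenvector_unique hw hAw hx
  obtain ⟨b, rfl⟩ := hA.intCast_map.complex_eigenvector_unique hw hAw hy
  have hb : b ≠ 0 := by
    rintro rfl
    exact hy₀ (zero_smul _ _)
  exact ⟨a / b, by rw [smul_smul, div_mul_cancel₀ _ hb]⟩

theorem perron_row_unique (hN : 0 < N) (hA : A.IsPrimitive) {x y : Fin N → ℂ}
    (hx : x ᵥ* A.map (Int.cast : ℤ → ℂ) = perronFrobenius A • x)
    (hy : y ᵥ* A.map (Int.cast : ℤ → ℂ) = perronFrobenius A • y) (hy₀ : y ≠ 0) :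
    ∃ t : ℂ, x = t • y := by
  rw [← perronFrobenius_transpose, ← Matrix.mulVec_transpose, ← intCast_transpose_map] at hx hy
  exact perron_column_unique hN hA.int_transpose hx hy hy₀

theorem perronFrobenius_mem_complexEigenvalues (hN : 0 < N) (hA : A.IsPrimitive) :
    perronFrobenius A ∈ complexEigenvalues A := by
  obtain ⟨r, v, w, hr, hv, hw, hAv, hAw, h⟩ := exists_perron_eigenvectors hN hA
  rw [h]
  refine mem_complexEigenvalues_iff.mpr ⟨fun i => (w i : ℂ), fun h0 => ?_, ?_⟩
  · have := congrFun h0 ⟨0, hN⟩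
    simp [(hw _).ne'] at this
  · ext i
    simpa [Matrix.mulVec, dotProduct] using congrArg (Complex.ofReal) (congrFun hAw i)

/-- Both vectors are nonzero complex multiples of positive ones. This is what later excludes
generalized eigenvectors for the Perron–Frobenius eigenvalue. -/
theorem perron_row_dotProduct_column_ne_zero (hN : 0 < N) (hA : A.IsPrimitive) {x y : Fin N → ℂ}
    (hx : x ᵥ* A.map (Int.cast : ℤ → ℂ) = perronFrobenius A • x) (hx₀ : x ≠ 0)
    (hy : A.map (Int.cast : ℤ → ℂ) *ᵥ y = perronFrobenius A • y) (hy₀ : y ≠ 0) :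
    x ⬝ᵥ y ≠ 0 := by
  have : Nonempty (Fin N) := ⟨⟨0, hN⟩⟩
  obtain ⟨r, v, w, hr, hv, hw, hAv, hAw, h⟩ := exists_perron_eigenvectors hN hA
  rw [h, ← intCast_map_complex] at hx hy
  rw [← Matrix.mulVec_transpose] at hAv hx
  obtain ⟨a, rfl⟩ := hA.intCast_map.transpose.complex_eigenvector_unique hv hAv hx
  obtain ⟨b, rfl⟩ := hA.intCast_map.complex_eigenvector_unique hw hAw hy
  have hvw : 0 < v ⬝ᵥ w :=
    Finset.sum_pos (fun i _ => mul_pos (hv i) (hw i)) Finset.univ_nonempty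
  have hcast : (fun i => (v i : ℂ)) ⬝ᵥ (fun i => (w i : ℂ)) = ((v ⬝ᵥ w : ℝ) : ℂ) := by
    simp [dotProduct]
  rw [smul_dotProduct, dotProduct_smul, hcast]
  refine smul_ne_zero ?_ (smul_ne_zero ?_ (by exact_mod_cast hvw.ne'))
  · rintro rfl
    exact hx₀ (zero_smul _ _)
  · rintro rfl
    exact hy₀ (zero_smul _ _)

end IntegerMatrices

/-! ### Maps of ordered dimension groups as rational matrices. -/

section DimensionGroups

variable {m n : ℕ} {A : Matrix (Fin m) (Fin m) ℤ} {B : Matrix (Fin n) (Fin n) ℤ}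

/-- The properties of the matrix of a map of ordered dimension groups used below: it maps the
lattices `A⁻ᵏℤᵐ` into the dimension group of `B`, and pulls Perron–Frobenius row eigenvectors of
`B` back to those of `A`. -/
structure IsDimensionMap (A : Matrix (Fin m) (Fin m) ℤ) (B : Matrix (Fin n) (Fin n) ℤ)
    (J : Matrix (Fin n) (Fin m) ℚ) : Prop where
  integral : ∀ k : ℕ, ∃ (l : ℕ) (M : Matrix (Fin n) (Fin m) ℤ),
    M.map (Int.cast : ℤ → ℚ) * A.map (Int.cast : ℤ → ℚ) ^ k =
      B.map (Int.cast : ℤ → ℚ) ^ l * J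
  row : ∀ x : Fin n → ℂ, x ᵥ* B.map (Int.cast : ℤ → ℂ) = perronFrobenius B • x →
    (x ᵥ* J.map (Rat.cast : ℚ → ℂ)) ᵥ* A.map (Int.cast : ℤ → ℂ) =
      perronFrobenius A • (x ᵥ* J.map (Rat.cast : ℚ → ℂ))

theorem intCast_mulVec (M : Matrix (Fin n) (Fin m) ℤ) (z : Fin m → ℤ) :
    (M.map (Int.cast : ℤ → ℚ)) *ᵥ (fun i => (z i : ℚ)) = fun i => ((M *ᵥ z) i : ℚ) := by
  ext i
  simp [Matrix.mulVec, dotProduct]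

/-- Finitely many elements of a dimension group become integral under a common power. -/
theorem exists_pow_mul_integral {κ : ℕ} (X : Matrix (Fin n) (Fin κ) ℚ)
    (hX : ∀ j, X.col j ∈ dimensionGroup B) :
    ∃ (l : ℕ) (M : Matrix (Fin n) (Fin κ) ℤ),
      M.map (Int.cast : ℤ → ℚ) = B.map (Int.cast : ℤ → ℚ) ^ l * X := by
  choose l z hz using hX
  have hle : ∀ j, l j ≤ Finset.univ.sup l := fun j => Finset.le_sup (Finset.mem_univ j)
  refine ⟨Finset.univ.sup l, Matrix.of fun i j => ((B ^ (Finset.univ.sup l - l j)) *ᵥ z j) i, ?_⟩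
  ext i j
  have h : B.map (Int.cast : ℤ → ℚ) ^ (Finset.univ.sup l) *ᵥ X.col j =
      fun i => (((B ^ (Finset.univ.sup l - l j)) *ᵥ z j) i : ℚ) := by
    rw [← intCast_mulVec, ← hz j, intCast_map_pow, Matrix.mulVec_mulVec, ← pow_add,
      Nat.sub_add_cancel (hle j)]
  exact (congrFun h i).symm

theorem exists_int_mul_eq_intCast {κ : Type*} [Finite κ] (g : κ → ℚ) :
    ∃ d : ℤ, d ≠ 0 ∧ ∃ z : κ → ℤ, ∀ i, (d : ℚ) * g i = z i := by
  cases nonempty_fintype κ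
  obtain ⟨⟨d, hd⟩, h⟩ := IsLocalization.exist_integer_multiples_of_finite (nonZeroDivisors ℤ) g
  choose z hz using h
  refine ⟨d, nonZeroDivisors.ne_zero hd, z, fun i => ?_⟩
  have := hz i
  simpa using this.symm

theorem intCast_mem_dimensionGroup (z : Fin m → ℤ) :
    (fun i => (z i : ℚ)) ∈ dimensionGroup A :=
  ⟨0, z, by simp⟩

/-- An additive map between dimension groups is given by a rational matrix. -/
theorem exists_matrix_of_addMonoidHom (φ : dimensionGroup A →+ dimensionGroup B) :
    ∃ J : Matrix (Fin n) (Fin m) ℚ, ∀ g : dimensionGroup A,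
      (φ g : Fin n → ℚ) = J *ᵥ (g : Fin m → ℚ) := by
  have hmem : ∀ j : Fin m, (Pi.single j 1 : Fin m → ℚ) ∈ dimensionGroup A := fun j => by
    convert intCast_mem_dimensionGroup (A := A) (Pi.single j 1) using 1
    ext i
    by_cases h : i = j
    · subst h; simp
    · simp [h]
  let J : Matrix (Fin n) (Fin m) ℚ :=
    Matrix.of fun i j => (φ ⟨Pi.single j 1, hmem j⟩ : Fin n → ℚ) i
  refine ⟨J, fun g => ?_⟩
  -- Clearing denominators makes `d • g` an integer combination of unit vectors; additivity
  -- determines `d • φ g`, and `d` can be cancelled in `ℚ`.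
  obtain ⟨d, hd, z, hz⟩ := exists_int_mul_eq_intCast (g : Fin m → ℚ)
  have hg : d • g = ∑ j, z j • (⟨Pi.single j 1, hmem j⟩ : dimensionGroup A) := by
    ext i
    simp [Finset.sum_apply, Pi.single_apply, hz]
  have hφ := congrArg (fun x : dimensionGroup B => (x : Fin n → ℚ)) (congrArg φ hg)
  have hd' : (d : ℚ) ≠ 0 := by exact_mod_cast hd
  ext i
  have hi := congrFun hφ i
  simp only [map_zsmul, map_sum, AddSubgroup.coe_zsmul, AddSubgroup.val_finsetSum,
    Finset.sum_apply, Pi.smul_apply, zsmul_eq_mul] at hi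
  refine mul_left_cancel₀ hd' (hi.trans ?_)
  rw [Matrix.mulVec, dotProduct, Finset.mul_sum]
  refine Finset.sum_congr rfl fun j _ => ?_
  rw [mul_left_comm, hz j, mul_comm]
  rfl

/-- A matrix is determined by its action on a dimension group. -/
theorem matrix_ext_of_dimensionGroup {κ : ℕ} {J J' : Matrix (Fin κ) (Fin m) ℚ}
    (h : ∀ g ∈ dimensionGroup A, J *ᵥ g = J' *ᵥ g) : J = J' := by
  refine Matrix.ext_of_mulVec_single fun j => h _ ?_
  convert intCast_mem_dimensionGroup (A := A) (Pi.single j 1) using 1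
  ext i
  by_cases h : i = j
  · subst h; simp
  · simp [h]

/-- The columns of `A⁻ᵏ` generate the lattice `A⁻ᵏ(ℤᵐ)` and lie in the positive cone, so they test
both integrality and positivity of a map. -/
theorem col_inv_pow_mem (hA₀ : A.det ≠ 0) (k : ℕ) (j : Fin m) :
    (((A.map (Int.cast : ℤ → ℚ))⁻¹ ^ k).col j) ∈ dimensionGroupNonneg A := by
  have hu := isUnit_intCast_map ℚ hA₀
  refine ⟨k, Pi.single j 1, ?_⟩
  have h : A.map (Int.cast : ℤ → ℚ) ^ k * (A.map (Int.cast : ℤ → ℚ))⁻¹ ^ k = 1 := by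
    rw [Matrix.inv_pow', Matrix.mul_nonsing_inv]
    exact (Matrix.isUnit_iff_isUnit_det _).mp (hu.pow k)
  ext i
  refine (congrFun (congrFun h i) j).trans ?_
  by_cases hij : i = j
  · subst hij
    simp
  · simp [hij]

theorem dimensionGroupNonneg_subset {g : Fin m → ℚ} (hg : g ∈ dimensionGroupNonneg A) :
    g ∈ dimensionGroup A := by
  obtain ⟨k, z, h⟩ := hg
  exact ⟨k, fun i => z i, by simpa using h⟩

/-- Integrality comes from finitely many lattice generators; the statement about rows comes from
positivity on all the cones `A⁻ᵏ(ℤ₊ᵐ)` at once. -/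
theorem isDimensionMap_of_mapsTo (hm : 0 < m) (hn : 0 < n) (hA : A.IsPrimitive)
    (hB : B.IsPrimitive) (hA₀ : A.det ≠ 0) {J : Matrix (Fin n) (Fin m) ℚ}
    (hJ : ∀ g ∈ dimensionGroup A, J *ᵥ g ∈ dimensionGroup B)
    (hJpos : ∀ g ∈ dimensionGroupNonneg A, J *ᵥ g ∈ dimensionGroupNonneg B) :
    IsDimensionMap A B J := by
  have : Nonempty (Fin m) := ⟨⟨0, hm⟩⟩
  have hu := isUnit_intCast_map ℚ hA₀
  have hdet : ∀ k, IsUnit (A.map (Int.cast : ℤ → ℚ) ^ k).det := fun k =>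
    (Matrix.isUnit_iff_isUnit_det _).mp (hu.pow k)
  refine ⟨fun k => ?_, fun x hx => ?_⟩
  · obtain ⟨l, M, h⟩ := exists_pow_mul_integral (B := B)
      (J * (A.map (Int.cast : ℤ → ℚ))⁻¹ ^ k)
      (fun j => hJ _ (dimensionGroupNonneg_subset (col_inv_pow_mem hA₀ k j)))
    refine ⟨l, M, ?_⟩
    rw [h, Matrix.mul_assoc, Matrix.mul_assoc, Matrix.inv_pow', Matrix.nonsing_inv_mul _ (hdet k), Matrix.mul_one]
  · obtain ⟨r, v, w, hr, hv, hw, hAv, hAw, hA'⟩ := exists_perron_eigenvectors hm hA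
    obtain ⟨s, y, -, hs, hy, -, hBy, -, hB'⟩ := exists_perron_eigenvectors hn hB
    -- `f k` lists the values of the functional `yJ` on the generators of `A⁻ᵏ(ℤ₊ᵐ)`.
    let f : ℕ → Fin m → ℝ := fun k =>
      y ᵥ* (J * (A.map (Int.cast : ℤ → ℚ))⁻¹ ^ k).map (Rat.cast : ℚ → ℝ)
    have hfpos : ∀ k, 0 ≤ f k := fun k j => by
      obtain ⟨l, z, hz⟩ := hJpos _ (col_inv_pow_mem hA₀ k j)
      -- Since `y Bˡ = sˡ y`, the sign can be read off after `Bˡ` has made the vector integral and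
      -- nonnegative.
      have hsf : s ^ l * f k j = ∑ i, y i * (z i : ℝ) := by
        have h1 : (y ᵥ* (B.map (Int.cast : ℤ → ℝ) ^ l *
            (J * (A.map (Int.cast : ℤ → ℚ))⁻¹ ^ k).map (Rat.cast : ℚ → ℝ))) j =
            s ^ l * f k j := by
          rw [← Matrix.vecMul_vecMul, Matrix.vecMul_pow_eigenvector hBy, Matrix.smul_vecMul]
          rfl
        rw [← h1, ← ratCast_map_intCast ℝ B, ← ratCast_map_pow, ← ratCast_map_mul]
        rw [Matrix.vecMul, dotProduct]
        refine Finset.sum_congr rfl fun i _ => congrArg (y i * ·) ?_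
        exact (congrArg (Rat.cast : ℚ → ℝ) (congrFun hz i)).trans (Rat.cast_natCast (z i))
      have hge : 0 ≤ s ^ l * f k j := by
        rw [hsf]
        exact Finset.sum_nonneg fun i _ => mul_nonneg (hy i).le (Nat.cast_nonneg _)
      exact nonneg_of_mul_nonneg_right hge (pow_pos hs l)
    have hstep : ∀ k l, f (k + l) ᵥ* A.map (Int.cast : ℤ → ℝ) ^ l = f k := fun k l => by
      simp only [f]
      rw [Matrix.vecMul_vecMul, ← ratCast_map_intCast ℝ A, ← ratCast_map_pow, ← ratCast_map_mul,
        pow_add, Matrix.mul_assoc, Matrix.mul_assoc, Matrix.inv_pow' _ l, Matrix.nonsing_inv_mul _ (hdet l),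
        mul_one]
    obtain ⟨t, ht⟩ := hA.intCast_map.backward_orbit_unique hr hv hw hAv hAw f hfpos hstep
    have hyC : (fun i => (y i : ℂ)) ᵥ* B.map (Int.cast : ℤ → ℂ) =
        perronFrobenius B • fun i => (y i : ℂ) := by
      rw [hB']
      ext i
      simpa [Matrix.vecMul, dotProduct] using congrArg (Complex.ofReal) (congrFun hBy i)
    have hy₀ : (fun i => (y i : ℂ)) ≠ 0 := fun h0 => by
      have := congrFun h0 ⟨0, hn⟩
      simp [(hy _).ne'] at this
    have hvC : (fun i => (v i : ℂ)) ᵥ* A.map (Int.cast : ℤ → ℂ) =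
        perronFrobenius A • fun i => (v i : ℂ) := by
      rw [hA']
      ext i
      simpa [Matrix.vecMul, dotProduct] using congrArg (Complex.ofReal) (congrFun hAv i)
    have hyJ : (fun i => (y i : ℂ)) ᵥ* J.map (Rat.cast : ℚ → ℂ) =
        (t : ℂ) • fun i => (v i : ℂ) := by
      ext i
      have := congrArg Complex.ofReal (congrFun ht i)
      simpa [f, Matrix.vecMul, dotProduct] using this
    obtain ⟨a, rfl⟩ := perron_row_unique hn hB hx hyC hy₀
    rw [Matrix.smul_vecMul, hyJ, Matrix.smul_vecMul, Matrix.smul_vecMul, hvC]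
    simp only [smul_smul]
    congr 1
    ring

/-- An isomorphism of ordered dimension groups is given by a rational matrix. -/
theorem OrderedDimensionGroupIso.exists_matrix (hm : 0 < m) (hn : 0 < n) (hA : A.IsPrimitive)
    (hB : B.IsPrimitive) (hA₀ : A.det ≠ 0) (hB₀ : B.det ≠ 0) (θ : OrderedDimensionGroupIso A B) :
    ∃ (J : Matrix (Fin n) (Fin m) ℚ) (J' : Matrix (Fin m) (Fin n) ℚ),
      J * J' = 1 ∧ J' * J = 1 ∧
      (∀ g : dimensionGroup A, (θ.toAddEquiv g : Fin n → ℚ) = J *ᵥ (g : Fin m → ℚ)) ∧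
      IsDimensionMap A B J ∧ IsDimensionMap B A J' := by
  obtain ⟨J, hJ⟩ := exists_matrix_of_addMonoidHom θ.toAddEquiv.toAddMonoidHom
  obtain ⟨J', hJ'⟩ := exists_matrix_of_addMonoidHom θ.toAddEquiv.symm.toAddMonoidHom
  simp only [AddEquiv.toAddMonoidHom_eq_coe, AddMonoidHom.coe_coe] at hJ hJ'
  have hmap : ∀ g ∈ dimensionGroup A, J *ᵥ g ∈ dimensionGroup B := fun g hg => by
    rw [← hJ ⟨g, hg⟩]
    exact (θ.toAddEquiv ⟨g, hg⟩).2
  have hmap' : ∀ g ∈ dimensionGroup B, J' *ᵥ g ∈ dimensionGroup A := fun g hg => by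
    rw [← hJ' ⟨g, hg⟩]
    exact (θ.toAddEquiv.symm ⟨g, hg⟩).2
  refine ⟨J, J', ?_, ?_, hJ, isDimensionMap_of_mapsTo hm hn hA hB hA₀ hmap fun g hg => ?_,
    isDimensionMap_of_mapsTo hn hm hB hA hB₀ hmap' fun g hg => ?_⟩
  · refine matrix_ext_of_dimensionGroup (A := B) fun g hg => ?_
    rw [← Matrix.mulVec_mulVec, ← hJ' ⟨g, hg⟩, ← hJ, AddEquiv.apply_symm_apply,
      Matrix.one_mulVec]
  · refine matrix_ext_of_dimensionGroup (A := A) fun g hg => ?_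
    rw [← Matrix.mulVec_mulVec, ← hJ ⟨g, hg⟩, ← hJ', AddEquiv.symm_apply_apply,
      Matrix.one_mulVec]
  · have hg' := dimensionGroupNonneg_subset hg
    rw [← hJ ⟨g, hg'⟩]
    exact (θ.nonneg_iff ⟨g, hg'⟩).mp hg
  · have hg' := dimensionGroupNonneg_subset hg
    rw [← hJ' ⟨g, hg'⟩]
    refine (θ.nonneg_iff _).mpr ?_
    change (θ.toAddEquiv (θ.toAddEquiv.symm ⟨g, hg'⟩) : Fin n → ℚ) ∈ _
    rwa [AddEquiv.apply_symm_apply]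

end DimensionGroups

/-! ### Divisibility by primes and integrality in a number field. -/

section Integers

variable {K : IntermediateField ℚ ℂ}

theorem exists_ringOfIntegers_eq {z : ℂ} (hz : z ∈ K) (hi : IsIntegral ℤ z) :
    ∃ a : 𝓞 K, algebraMap (𝓞 K) ℂ a = z := by
  have h : IsIntegral ℤ (⟨z, hz⟩ : K) :=
    (isIntegral_algebraMap_iff (R := ℤ) (A := K) (B := ℂ) (algebraMap K ℂ).injective).mp hi
  exact ⟨⟨⟨z, hz⟩, h⟩, rfl⟩

theorem algebraMap_ringOfIntegers_injective :
    Function.Injective (algebraMap (𝓞 K) ℂ) := FaithfulSMul.algebraMap_injective _ _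

theorem isIntegral_algebraMap_ringOfIntegers (a : 𝓞 K) : IsIntegral ℤ (algebraMap (𝓞 K) ℂ a) :=
  (NumberField.RingOfIntegers.isIntegral a).algebraMap

theorem algebraMap_ringOfIntegers_mem (a : 𝓞 K) : algebraMap (𝓞 K) ℂ a ∈ K :=
  (a : K).2

variable [NumberField K]

theorem primeDivides_algebraMap_iff {p : HeightOneSpectrum (𝓞 K)} {a : 𝓞 K} :
    PrimeDivides p (algebraMap (𝓞 K) ℂ a) ↔ a ∈ p.asIdeal := by
  constructor
  · rintro ⟨b, hb, h⟩
    rw [algebraMap_ringOfIntegers_injective hb] at h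
    exact Ideal.dvd_span_singleton.mp h
  · exact fun h => ⟨a, rfl, Ideal.dvd_span_singleton.mpr h⟩

/-- If `z` divides a power of `z'`, then the primes dividing `z` divide `z'`. -/
theorem PrimeDivides.of_isIntegral_div {p : HeightOneSpectrum (𝓞 K)} {z z' : ℂ} (hz₀ : z ≠ 0)
    (hz' : z' ∈ K) (hi' : IsIntegral ℤ z') {l : ℕ} (h : IsIntegral ℤ (z' ^ l / z))
    (hp : PrimeDivides p z) : PrimeDivides p z' := by
  obtain ⟨a, rfl, ha⟩ := id hp
  rw [Ideal.dvd_span_singleton] at ha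
  obtain ⟨b, rfl⟩ := exists_ringOfIntegers_eq hz' hi'
  obtain ⟨d, hd⟩ := exists_ringOfIntegers_eq
    (div_mem (pow_mem hz' l) (algebraMap_ringOfIntegers_mem a)) h
  have hbl : b ^ l = d * a := by
    apply algebraMap_ringOfIntegers_injective
    rw [map_pow, map_mul, hd, div_mul_cancel₀ _ hz₀]
  rw [primeDivides_algebraMap_iff]
  exact p.isPrime.mem_of_pow_mem l (hbl ▸ p.asIdeal.mul_mem_left d ha)

theorem count_spanSingleton_eq_zero {p : HeightOneSpectrum (𝓞 K)} {a : 𝓞 K} (ha₀ : a ≠ 0)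
    (ha : a ∉ p.asIdeal) :
    FractionalIdeal.count K p (FractionalIdeal.spanSingleton (𝓞 K)⁰ (algebraMap (𝓞 K) K a)) =
      0 := by
  have hne : Ideal.span {a} ≠ 0 := by simpa using ha₀
  rw [← FractionalIdeal.coeIdeal_span_singleton, FractionalIdeal.count_coe K p hne]
  have := (Associates.count_ne_zero_iff_dvd hne p.irreducible).not.mpr
    (fun h => ha (Ideal.dvd_span_singleton.mp h))
  simpa using this

/-- If `c zᵏ` is integral and `z` is prime to `p`, then `c` has nonnegative valuation at `p`. -/
theorem count_nonneg_of_isIntegral_mul_pow {p : HeightOneSpectrum (𝓞 K)} {c : K} (hc : c ≠ 0)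
    {a : 𝓞 K} (ha₀ : a ≠ 0) (ha : a ∉ p.asIdeal) {k : ℕ}
    (h : IsIntegral ℤ ((c : ℂ) * algebraMap (𝓞 K) ℂ a ^ k)) :
    0 ≤ FractionalIdeal.count K p (FractionalIdeal.spanSingleton (𝓞 K)⁰ c) := by
  obtain ⟨b, hb⟩ := exists_ringOfIntegers_eq
    (mul_mem c.2 (pow_mem (algebraMap_ringOfIntegers_mem a) k)) h
  have hbK : algebraMap (𝓞 K) K b = c * algebraMap (𝓞 K) K a ^ k :=
    (algebraMap K ℂ).injective hb
  have hak : algebraMap (𝓞 K) K a ^ k ≠ 0 :=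
    pow_ne_zero k (by simpa using ha₀)
  have hcount : FractionalIdeal.count K p
      (FractionalIdeal.spanSingleton (𝓞 K)⁰ (algebraMap (𝓞 K) K b)) =
      FractionalIdeal.count K p (FractionalIdeal.spanSingleton (𝓞 K)⁰ c) := by
    rw [hbK, ← FractionalIdeal.spanSingleton_mul_spanSingleton,
      FractionalIdeal.count_mul K p (FractionalIdeal.spanSingleton_ne_zero_iff.mpr hc)
        (FractionalIdeal.spanSingleton_ne_zero_iff.mpr hak),
      ← map_pow, count_spanSingleton_eq_zero (pow_ne_zero k ha₀)
        (fun h => ha (p.isPrime.mem_of_pow_mem k h)), add_zero]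
  rw [← hcount, ← FractionalIdeal.coeIdeal_span_singleton]
  exact FractionalIdeal.count_coe_nonneg K p _

/-- An element which becomes integral, as does its inverse, after multiplication by powers of
`z` factors into the primes dividing `z`. -/
theorem factorsIntoPrimesOf_of_isIntegral {c : K} (hc : c ≠ 0) {z : ℂ} (hz : z ∈ K)
    (hz₀ : z ≠ 0) (hzi : IsIntegral ℤ z) {k k' : ℕ} (h : IsIntegral ℤ ((c : ℂ) * z ^ k))
    (h' : IsIntegral ℤ ((c : ℂ)⁻¹ * z ^ k')) : FactorsIntoPrimesOf c z := by
  obtain ⟨a, rfl⟩ := exists_ringOfIntegers_eq hz hzi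
  have ha₀ : a ≠ 0 := by
    rintro rfl
    simp at hz₀
  have hne : Ideal.span {a} ≠ 0 := by simpa using ha₀
  have hfin := Ideal.finite_factors hne
  have hI : FractionalIdeal.spanSingleton (𝓞 K)⁰ c ≠ 0 :=
    FractionalIdeal.spanSingleton_ne_zero_iff.mpr hc
  refine ⟨hfin.toFinset, fun p => FractionalIdeal.count K p
    (FractionalIdeal.spanSingleton (𝓞 K)⁰ c), fun p hp => ⟨a, rfl, by simpa using hp⟩, ?_⟩
  rw [← finprod_eq_prod_of_mulSupport_subset, FractionalIdeal.finprod_heightOneSpectrum_factorization' K hI]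
  intro p hp
  by_contra hpa
  refine hp ?_
  have ha : a ∉ p.asIdeal := fun h => hpa (by simpa using Ideal.dvd_span_singleton.mpr h)
  -- At a prime not dividing `z`, both `c` and `c⁻¹` have nonnegative valuation, so the exponent is
  -- zero.
  have h1 := count_nonneg_of_isIntegral_mul_pow hc ha₀ ha h
  have h2 := count_nonneg_of_isIntegral_mul_pow (inv_ne_zero hc) ha₀ ha
    (by simpa using h')
  rw [← FractionalIdeal.spanSingleton_inv, FractionalIdeal.count_inv] at h2
  have h0 : FractionalIdeal.count K p (FractionalIdeal.spanSingleton (𝓞 K)⁰ c) = 0 := by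
    linarith
  simp only [h0, zpow_zero]

/-- A nonzero number cannot be divisible by all powers of `z` up to powers of `μ` if some prime
divides `z` but not `μ`. -/
theorem eq_zero_of_forall_isIntegral {p : HeightOneSpectrum (𝓞 K)} {z μ y : ℂ} (hz₀ : z ≠ 0)
    (hzp : PrimeDivides p z) (hμ : μ ∈ K) (hμ₀ : μ ≠ 0) (hμi : IsIntegral ℤ μ)
    (hμp : ¬ PrimeDivides p μ) (hy : y ∈ K)
    (h : ∀ k : ℕ, ∃ l : ℕ, IsIntegral ℤ (z⁻¹ ^ k * (μ ^ l * y))) : y = 0 := by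
  by_contra hy₀
  obtain ⟨a, rfl, ha⟩ := id hzp
  rw [Ideal.dvd_span_singleton] at ha
  obtain ⟨b, rfl⟩ := exists_ringOfIntegers_eq hμ hμi
  rw [primeDivides_algebraMap_iff] at hμp
  -- The integer `x = μ ^ l₀ * y` lies in every power of `p`, because `μ` is prime to `p`; Krull's
  -- intersection theorem gives `x = 0`.
  obtain ⟨l₀, h₀⟩ := h 0
  rw [pow_zero, one_mul] at h₀
  obtain ⟨x, hx⟩ := exists_ringOfIntegers_eq (mul_mem (pow_mem hμ l₀) hy) h₀
  have hxmem : ∀ k : ℕ, x ∈ p.asIdeal ^ k := fun k => by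
    obtain ⟨l, hl⟩ := h k
    obtain ⟨d, hd⟩ := exists_ringOfIntegers_eq (mul_mem (pow_mem (inv_mem
      (algebraMap_ringOfIntegers_mem a)) k) (mul_mem (pow_mem hμ l) hy)) hl
    have heq : b ^ l * x = b ^ l₀ * d * a ^ k := by
      apply algebraMap_ringOfIntegers_injective
      simp only [map_mul, map_pow, hd, hx]
      rw [inv_pow]
      field_simp
    refine ((Ideal.IsPrime.mul_mem_pow p.asIdeal (hI := p.isPrime) (a := b ^ l) ?_).resolve_left
      fun hb => hμp (p.isPrime.mem_of_pow_mem l hb))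
    rw [heq]
    exact Ideal.mul_mem_left _ _ (Ideal.pow_mem_pow ha k)
  have hx0 : x ∈ ⨅ i : ℕ, p.asIdeal ^ i := by simpa [Submodule.mem_iInf] using hxmem
  rw [Ideal.iInf_pow_eq_bot_of_isDomain _ p.isPrime.ne_top, Ideal.mem_bot] at hx0
  rw [hx0, map_zero] at hx
  exact mul_ne_zero (pow_ne_zero l₀ hμ₀) hy₀ hx.symm

end Integers

/-! ### Vectors with gcd 1. -/

section Normalization

variable {N : ℕ}

/-- If all ideals of `F` become principal in `E`, a vector over `F` can be rescaled to an integral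
vector over `E` with gcd `1`. -/
theorem exists_normalized_smul {F E : IntermediateField ℚ ℂ} [NumberField F]
    (hFE : F ≤ E) (hE : IdealsBecomePrincipal hFE) {x : Fin N → ℂ} (hx₀ : x ≠ 0) (hx : ∀ i, x i ∈ F) :
    ∃ (t : ℂ) (v : Fin N → 𝓞 E), Ideal.span (Set.range v) = ⊤ ∧ toComplex v = t • x := by
  obtain ⟨⟨d, hd⟩, hint⟩ := IsLocalization.exist_integer_multiples_of_finite
    (nonZeroDivisors (𝓞 F)) (fun i => (⟨x i, hx i⟩ : F))
  have hd₀ : d ≠ 0 := nonZeroDivisors.ne_zero hd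
  choose a ha using hint
  have haC : ∀ i, algebraMap (𝓞 F) ℂ (a i) = algebraMap (𝓞 F) ℂ d * x i := fun i =>
    congrArg (algebraMap F ℂ) (ha i)
  set φ := NumberField.RingOfIntegers.mapRingHom (IntermediateField.inclusion hFE).toRingHom with hφ
  have hφC : ∀ b : 𝓞 F, algebraMap (𝓞 E) ℂ (φ b) = algebraMap (𝓞 F) ℂ b := fun b => rfl
  -- `g` is a gcd in `𝓞 E` of the entries cleared of denominators by `d`; the normalized vector is
  -- `(d / g) x`.
  obtain ⟨g, hg⟩ := hE (Ideal.span (Set.range a))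
  rw [Ideal.map_span, ← Set.range_comp] at hg
  have hdvd : ∀ i, ∃ b : 𝓞 E, g * b = φ (a i) := fun i => by
    have h : φ (a i) ∈ Ideal.span {g} := by
      rw [← Ideal.submodule_span_eq, ← hg]
      exact Ideal.subset_span ⟨i, rfl⟩
    obtain ⟨b, hb⟩ := Ideal.mem_span_singleton.mp h
    exact ⟨b, hb.symm⟩
  choose b hb using hdvd
  have hdC : algebraMap (𝓞 F) ℂ d ≠ 0 := fun h0 =>
    hd₀ (algebraMap_ringOfIntegers_injective (h0.trans (map_zero _).symm))
  have hg₀ : g ≠ 0 := by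
    rintro rfl
    refine hx₀ (funext fun i => ?_)
    have := haC i
    rw [← hφC, ← hb i, zero_mul, map_zero] at this
    exact (mul_eq_zero.mp this.symm).resolve_left hdC
  have hgC : algebraMap (𝓞 E) ℂ g ≠ 0 := fun h0 =>
    hg₀ (algebraMap_ringOfIntegers_injective (h0.trans (map_zero _).symm))
  refine ⟨(algebraMap (𝓞 E) ℂ g)⁻¹ * algebraMap (𝓞 F) ℂ d, b, ?_, ?_⟩
  · have hgmem : g ∈ Ideal.span (Set.range (φ ∘ a)) := by
      rw [hg]
      exact Submodule.mem_span_singleton_self g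
    obtain ⟨c, hc⟩ := (Ideal.mem_span_range_iff_exists_fun).mp hgmem
    rw [Ideal.eq_top_iff_one]
    refine Ideal.mem_span_range_iff_exists_fun.mpr ⟨c, mul_left_cancel₀ hg₀ ?_⟩
    rw [Finset.mul_sum, mul_one]
    conv_rhs => rw [← hc]
    exact Finset.sum_congr rfl fun i _ => by
      rw [mul_left_comm, hb]
      rfl
  · ext i
    rw [Pi.smul_apply, smul_eq_mul, mul_assoc, ← haC, ← hφC, ← hb, map_mul,
      inv_mul_cancel_left₀ hgC]
    rfl

/-- If a multiple of a vector with gcd `1` is integral, so is the multiplier. -/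
theorem isIntegral_of_smul_toComplex {E : IntermediateField ℚ ℂ} {v : Fin N → 𝓞 E}
    (hv : Ideal.span (Set.range v) = ⊤) {t : ℂ} (h : ∀ i, IsIntegral ℤ (t * toComplex v i)) :
    IsIntegral ℤ t := by
  obtain ⟨c, hc⟩ := Ideal.mem_span_range_iff_exists_fun.mp ((Ideal.eq_top_iff_one _).mp hv)
  -- Multiply a Bézout relation among the entries of `v` by `t`.
  have ht : t = ∑ i, algebraMap (𝓞 E) ℂ (c i) * (t * toComplex v i) := by
    calc t = t * algebraMap (𝓞 E) ℂ (∑ i, c i * v i) := by rw [hc, map_one, mul_one]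
      _ = _ := by
        rw [map_sum, Finset.mul_sum]
        refine Finset.sum_congr rfl fun i _ => ?_
        rw [map_mul, toComplex]
        ring
  rw [ht]
  exact IsIntegral.sum _ fun i _ => (isIntegral_algebraMap_ringOfIntegers _).mul (h i)

theorem toComplex_ne_zero {E : IntermediateField ℚ ℂ} {v : Fin N → 𝓞 E}
    (hv : Ideal.span (Set.range v) = ⊤) : toComplex v ≠ 0 := by
  intro h0
  have h : Ideal.span (Set.range v) = ⊥ := by
    rw [Ideal.span_eq_bot]
    rintro _ ⟨i, rfl⟩
    exact algebraMap_ringOfIntegers_injective ((congrFun h0 i).trans (map_zero _).symm)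
  exact bot_ne_top (h.symm.trans hv)

theorem toComplex_mem {E : IntermediateField ℚ ℂ} (v : Fin N → 𝓞 E) (i : Fin N) :
    toComplex v i ∈ E := algebraMap_ringOfIntegers_mem _

theorem isIntegral_toComplex {E : IntermediateField ℚ ℂ} (v : Fin N → 𝓞 E) (i : Fin N) :
    IsIntegral ℤ (toComplex v i) := isIntegral_algebraMap_ringOfIntegers _

end Normalization

/-! ### Comparison of the two Perron–Frobenius eigenvalues. -/

section DimensionMap

variable {m n : ℕ} {A : Matrix (Fin m) (Fin m) ℤ} {B : Matrix (Fin n) (Fin n) ℤ}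
  {J : Matrix (Fin n) (Fin m) ℚ} {J' : Matrix (Fin m) (Fin n) ℚ}

theorem IsDimensionMap.integral_complex (hJ : IsDimensionMap A B J) (k : ℕ) :
    ∃ (l : ℕ) (M : Matrix (Fin n) (Fin m) ℤ),
      M.map (Int.cast : ℤ → ℂ) * A.map (Int.cast : ℤ → ℂ) ^ k =
        B.map (Int.cast : ℤ → ℂ) ^ l * J.map (Rat.cast : ℚ → ℂ) := by
  obtain ⟨l, M, h⟩ := hJ.integral k
  refine ⟨l, M, ?_⟩
  have := congrArg (fun X => X.map (Rat.cast : ℚ → ℂ)) h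
  simpa only [ratCast_map_mul, ratCast_map_pow, ratCast_map_intCast] using this

theorem ratCast_map_mul_eq_one (h : J * J' = 1) :
    J.map (Rat.cast : ℚ → ℂ) * J'.map (Rat.cast : ℚ → ℂ) = 1 := by
  rw [← ratCast_map_mul, h, ratCast_map_one]

theorem vecMul_ratCast_ne_zero (h : J * J' = 1) {x : Fin n → ℂ} (hx : x ≠ 0) :
    x ᵥ* J.map (Rat.cast : ℚ → ℂ) ≠ 0 := by
  intro h0
  apply hx
  rw [← Matrix.vecMul_one x, ← ratCast_map_mul_eq_one h, ← Matrix.vecMul_vecMul, h0,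
    Matrix.zero_vecMul]

/-- The Perron–Frobenius eigenvalue of `A` divides a power of that of `B`. -/
theorem IsDimensionMap.exists_isIntegral_pow_div (hm : 0 < m) (hn : 0 < n) (hA : A.IsPrimitive)
    (hB : B.IsPrimitive) (hA₀ : A.det ≠ 0) (hJ : IsDimensionMap A B J)
    (hJ' : IsDimensionMap B A J') (h : J * J' = 1) :
    ∃ l : ℕ, IsIntegral ℤ (perronFrobenius B ^ l / perronFrobenius A) := by
  obtain ⟨x, hx₀, -, hx⟩ := exists_row_eigenvector_mem (K := ⊤) IntermediateField.mem_top
    (perronFrobenius_mem_complexEigenvalues hn hB)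
  have hy := hJ.row x hx
  set y := x ᵥ* J.map (Rat.cast : ℚ → ℂ) with hydef
  have hr := perronFrobenius_ne_zero hm hA
  obtain ⟨a, M', hM'⟩ := hJ'.integral_complex 0
  -- `M'` contributes `λᵃ`, so the exponent `a + 1` leaves exactly one factor `λ` in the
  -- denominator: `x M M' = (λ'ˡ/λ) x`.
  obtain ⟨l, M, hM⟩ := hJ.integral_complex (a + 1)
  rw [pow_zero, Matrix.mul_one] at hM'
  have hyM' : y ᵥ* M'.map (Int.cast : ℤ → ℂ) = perronFrobenius A ^ a • x := by
    rw [hM', ← Matrix.vecMul_vecMul, Matrix.vecMul_pow_eigenvector hy, Matrix.smul_vecMul, hydef,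
      Matrix.vecMul_vecMul, ratCast_map_mul_eq_one h, Matrix.vecMul_one]
  have hxM : perronFrobenius A ^ (a + 1) • (x ᵥ* M.map (Int.cast : ℤ → ℂ)) =
      perronFrobenius B ^ l • y := by
    apply Matrix.vecMul_injective_of_isUnit ((isUnit_intCast_map ℂ hA₀).pow (a + 1))
    dsimp only
    rw [Matrix.smul_vecMul, Matrix.vecMul_vecMul, hM, ← Matrix.vecMul_vecMul,
      Matrix.vecMul_pow_eigenvector hx, Matrix.smul_vecMul, Matrix.smul_vecMul,
      Matrix.vecMul_pow_eigenvector hy, smul_comm]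
  refine ⟨l, isIntegral_of_vecMul_eq_smul (A := M * M') hx₀ ?_⟩
  apply smul_right_injective _ (pow_ne_zero (a + 1) hr)
  dsimp only
  rw [intCast_map_mul, ← Matrix.vecMul_vecMul, ← Matrix.smul_vecMul, hxM, Matrix.smul_vecMul,
    hyM', smul_smul, smul_smul]
  congr 1
  rw [pow_succ]
  field_simp

theorem vecMul_ratCast_mem {K : IntermediateField ℚ ℂ} {x : Fin n → ℂ} (hx : ∀ i, x i ∈ K)
    (J : Matrix (Fin n) (Fin m) ℚ) (i : Fin m) : (x ᵥ* J.map (Rat.cast : ℚ → ℂ)) i ∈ K := by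
  rw [Matrix.vecMul, dotProduct]
  exact sum_mem fun j _ => mul_mem (hx j) (SubfieldClass.ratCast_mem K (J j i))

theorem mulVec_ratCast_mem {K : IntermediateField ℚ ℂ} {x : Fin m → ℂ} (hx : ∀ i, x i ∈ K)
    (J : Matrix (Fin n) (Fin m) ℚ) (i : Fin n) : (J.map (Rat.cast : ℚ → ℂ) *ᵥ x) i ∈ K := by
  rw [Matrix.mulVec, dotProduct]
  exact sum_mem fun j _ => mul_mem (SubfieldClass.ratCast_mem K (J i j)) (hx j)

theorem mem_of_smul_mem {K : IntermediateField ℚ ℂ} {x : Fin n → ℂ} (hx₀ : x ≠ 0)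
    (hx : ∀ i, x i ∈ K) {t : ℂ} (ht : ∀ i, (t • x) i ∈ K) : t ∈ K := by
  obtain ⟨i, hi⟩ := Function.ne_iff.mp hx₀
  rw [← mul_div_cancel_right₀ t hi]
  exact div_mem (ht i) (hx i)

/-- The rational matrix `J A J'` has a row eigenvector with entries in `ℚ(λ')` and eigenvalue `λ`;
comparing a nonzero entry puts `λ` in that field. -/
theorem IsDimensionMap.perronFrobenius_mem (hn : 0 < n) (hB : B.IsPrimitive)
    (hJ : IsDimensionMap A B J) (h : J * J' = 1) :
    perronFrobenius A ∈ ℚ⟮perronFrobenius B⟯ := by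
  obtain ⟨x, hx₀, hxK, hx⟩ := exists_row_eigenvector_mem
    (IntermediateField.mem_adjoin_simple_self ℚ (perronFrobenius B))
    (perronFrobenius_mem_complexEigenvalues hn hB)
  have hM : x ᵥ* (J * A.map (Int.cast : ℤ → ℚ) * J').map (Rat.cast : ℚ → ℂ) =
      perronFrobenius A • x := by
    rw [ratCast_map_mul, ratCast_map_mul, ratCast_map_intCast, ← Matrix.vecMul_vecMul,
      ← Matrix.vecMul_vecMul, hJ.row x hx, Matrix.smul_vecMul, Matrix.vecMul_vecMul,
      ratCast_map_mul_eq_one h, Matrix.vecMul_one]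
  refine mem_of_smul_mem hx₀ hxK fun i => ?_
  rw [← hM]
  exact vecMul_ratCast_mem hxK _ i

end DimensionMap

/-! ### Infinitely divisible vectors and separation by primes. -/

section InfinitelyDivisible

variable {n : ℕ} {B : Matrix (Fin n) (Fin n) ℤ} {E : IntermediateField ℚ ℂ} {z : ℂ}

/-- The vector `x` over `E` is divisible by all powers of `z` in `⋃ B⁻ˡ(𝓞_E)ⁿ`. -/
def IsInfinitelyDivisible (E : IntermediateField ℚ ℂ) (B : Matrix (Fin n) (Fin n) ℤ) (z : ℂ)
    (x : Fin n → ℂ) : Prop :=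
  (∀ i, x i ∈ E) ∧
    ∀ k : ℕ, ∃ l : ℕ, ∀ i, IsIntegral ℤ (z⁻¹ ^ k * (B.map (Int.cast : ℤ → ℂ) ^ l *ᵥ x) i)

theorem isIntegral_mulVec {m : ℕ} (M : Matrix (Fin n) (Fin m) ℤ) {t : ℂ} {x : Fin m → ℂ}
    (hx : ∀ i, IsIntegral ℤ (t * x i)) (i : Fin n) :
    IsIntegral ℤ (t * (M.map (Int.cast : ℤ → ℂ) *ᵥ x) i) := by
  rw [Matrix.mulVec, dotProduct, Finset.mul_sum]
  refine IsIntegral.sum _ fun j _ => ?_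
  rw [mul_left_comm]
  exact (isIntegral_algebraMap (R := ℤ) (A := ℂ) (x := M i j)).mul (hx j)

/-- Divisibility survives because `B - μ` commutes with `Bˡ` and preserves integrality. It allows
linear factors of the characteristic polynomial to be removed one at a time. -/
theorem IsInfinitelyDivisible.mulVec_sub_smul {x : Fin n → ℂ} (hx : IsInfinitelyDivisible E B z x)
    {μ : ℂ} (hμ : μ ∈ E) (hμi : IsIntegral ℤ μ) :
    IsInfinitelyDivisible E B z (B.map (Int.cast : ℤ → ℂ) *ᵥ x - μ • x) := by
  refine ⟨fun i => ?_, fun k => ?_⟩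
  · rw [← ratCast_map_intCast ℂ B]
    exact sub_mem (mulVec_ratCast_mem hx.1 _ i) (mul_mem hμ (hx.1 i))
  · obtain ⟨l, hl⟩ := hx.2 k
    refine ⟨l, fun i => ?_⟩
    rw [Matrix.mulVec_sub, Matrix.mulVec_smul, Matrix.mulVec_mulVec, ← pow_succ, pow_succ',
      ← Matrix.mulVec_mulVec, Pi.sub_apply, mul_sub, Pi.smul_apply, smul_eq_mul, mul_left_comm]
    exact (isIntegral_mulVec B hl i).sub (hμi.mul (hl i))

variable [NumberField E]

/-- On `x` the power `Bˡ` is multiplication by `μˡ`, which cannot supply the factors of `p` demanded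
by arbitrary powers of `z`. -/
theorem IsInfinitelyDivisible.eq_zero_of_eigenvector {x : Fin n → ℂ}
    (hx : IsInfinitelyDivisible E B z x) (hz₀ : z ≠ 0) (hB₀ : B.det ≠ 0) {μ : ℂ} (hμE : μ ∈ E)
    (hμ : μ ∈ complexEigenvalues B)
    (hp : ∃ p : HeightOneSpectrum (𝓞 E), PrimeDivides p z ∧ ¬ PrimeDivides p μ)
    (h : B.map (Int.cast : ℤ → ℂ) *ᵥ x = μ • x) : x = 0 := by
  obtain ⟨p, hpz, hpμ⟩ := hp
  ext i
  refine eq_zero_of_forall_isIntegral hz₀ hpz hμE (ne_zero_of_mem_complexEigenvalues hB₀ hμ)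
    (isIntegral_of_mem_complexEigenvalues hμ) hpμ (hx.1 i) fun k => ?_
  obtain ⟨l, hl⟩ := hx.2 k
  refine ⟨l, ?_⟩
  have := hl i
  rwa [Matrix.pow_mulVec_eigenvector h] at this

/-- If the primes dividing `z` separate the Perron–Frobenius eigenvalue of `B` from the other
eigenvalues, an infinitely `z`-divisible vector is a Perron–Frobenius eigenvector. -/
theorem IsInfinitelyDivisible.mulVec_eq (hn : 0 < n) (hB : B.IsPrimitive) (hB₀ : B.det ≠ 0)
    (hz₀ : z ≠ 0) (hsub : ∀ μ ∈ complexEigenvalues B, μ ∈ E) (hsep : PrimesSeparate E B z)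
    {x : Fin n → ℂ} (hx : IsInfinitelyDivisible E B z x) :
    B.map (Int.cast : ℤ → ℂ) *ᵥ x = perronFrobenius B • x := by
  have hpf := perronFrobenius_mem_complexEigenvalues hn hB
  obtain ⟨v, hv₀, -, hv⟩ := exists_row_eigenvector_mem (K := ⊤) IntermediateField.mem_top hpf
  -- Induction on the linear factors of a polynomial in `B` annihilating `x`; Cayley–Hamilton
  -- supplies the initial one.
  have key : ∀ s : Multiset ℂ, (∀ μ ∈ s, μ ∈ complexEigenvalues B) → ∀ x : Fin n → ℂ,
      IsInfinitelyDivisible E B z x →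
      (Polynomial.aeval (B.map (Int.cast : ℤ → ℂ))
        (s.map fun μ => Polynomial.X - Polynomial.C μ).prod) *ᵥ x = 0 →
      B.map (Int.cast : ℤ → ℂ) *ᵥ x = perronFrobenius B • x := by
    intro s
    induction s using Multiset.induction with
    | empty =>
      intro _ x _ h
      simp only [Multiset.map_zero, Multiset.prod_zero, map_one, Matrix.one_mulVec] at h
      simp [h]
    | cons a s ih =>
      intro hs x hx h
      have ha := hs a (Multiset.mem_cons_self a s)
      rw [Multiset.map_cons, Multiset.prod_cons, mul_comm, map_mul, map_sub, Polynomial.aeval_X,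
        Polynomial.aeval_C, Algebra.algebraMap_eq_smul_one, ← Matrix.mulVec_mulVec,
        Matrix.sub_mulVec, Matrix.smul_mulVec, Matrix.one_mulVec] at h
      have h1 := ih (fun μ hμ => hs μ (Multiset.mem_cons_of_mem hμ)) _
        (hx.mulVec_sub_smul (hsub a ha) (isIntegral_of_mem_complexEigenvalues ha)) h
      rw [← sub_eq_zero]
      -- The induction hypothesis makes `(B - a)x` an eigenvector for `λ'` or zero. If `a = λ'`, it
      -- is also orthogonal to the left eigenvector `v`, hence zero. If not, commuting the factors
      -- gives `(B - a)(B - λ')x = 0`, and the separating prime forces `(B - λ')x = 0`.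
      by_cases hapf : a = perronFrobenius B
      · rw [hapf] at h1
        by_contra hne
        refine perron_row_dotProduct_column_ne_zero hn hB hv hv₀ h1 hne ?_
        rw [dotProduct_sub, Matrix.dotProduct_mulVec, hv, smul_dotProduct, dotProduct_smul,
          sub_self]
      · refine (hx.mulVec_sub_smul (hsub _ hpf)
          (isIntegral_of_mem_complexEigenvalues hpf)).eq_zero_of_eigenvector hz₀ hB₀ (hsub a ha) ha
          (hsep a ha hapf) ?_
        rw [Matrix.mulVec_sub, Matrix.mulVec_smul] at h1 ⊢
        ext i
        have h2 := congrFun h1 i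
        simp only [Pi.sub_apply, Pi.smul_apply, smul_eq_mul] at h2 ⊢
        linear_combination h2
  refine key (B.map (Int.cast : ℤ → ℂ)).charpoly.roots (fun μ hμ => ?_) x hx ?_
  · exact Matrix.mem_spectrum_iff_isRoot_charpoly.mpr (Polynomial.isRoot_of_mem_roots hμ)
  · rw [← (IsAlgClosed.splits _).eq_prod_roots_of_monic (Matrix.charpoly_monic _),
      Matrix.aeval_self_charpoly, Matrix.zero_mulVec]

end InfinitelyDivisible

/-! ### Scalars relating the normalized eigenvectors. -/

section Eigenvectors

variable {m n : ℕ} {A : Matrix (Fin m) (Fin m) ℤ} {B : Matrix (Fin n) (Fin n) ℤ}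
  {J : Matrix (Fin n) (Fin m) ℚ} {J' : Matrix (Fin m) (Fin n) ℚ} {E : IntermediateField ℚ ℂ}

/-- From `M Aᵏ = Bˡ J` one gets `Bˡ J w = λᵏ M w` with `M w` integral. -/
theorem IsDimensionMap.isInfinitelyDivisible (hJ : IsDimensionMap A B J)
    (hr : perronFrobenius A ≠ 0) {w : Fin m → 𝓞 E} (hw : IsNormalizedColumn A w) :
    IsInfinitelyDivisible E B (perronFrobenius A) (J.map (Rat.cast : ℚ → ℂ) *ᵥ toComplex w) := by
  refine ⟨mulVec_ratCast_mem (toComplex_mem w) J, fun k => ?_⟩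
  obtain ⟨l, M, hM⟩ := hJ.integral_complex k
  refine ⟨l, fun i => ?_⟩
  rw [Matrix.mulVec_mulVec, ← hM, ← Matrix.mulVec_mulVec, Matrix.pow_mulVec_eigenvector hw.2,
    Matrix.mulVec_smul, Pi.smul_apply, smul_eq_mul, inv_pow,
    inv_mul_cancel_left₀ (pow_ne_zero k hr), ← one_mul ((_ *ᵥ _) i)]
  exact isIntegral_mulVec M (by simpa using isIntegral_toComplex w) i

/-- For some `l` the matrix `Bˡ J` is integral, so `t λ'ˡ w'` is an integral vector; gcd 1 of `w'`
passes this on to the scalar. -/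
theorem IsDimensionMap.exists_isIntegral_of_column (hJ : IsDimensionMap A B J)
    {w : Fin m → 𝓞 E} {w' : Fin n → 𝓞 E} (hw' : IsNormalizedColumn B w') {t : ℂ}
    (h : J.map (Rat.cast : ℚ → ℂ) *ᵥ toComplex w = t • toComplex w') :
    ∃ l : ℕ, IsIntegral ℤ (t * perronFrobenius B ^ l) := by
  obtain ⟨l, M, hM⟩ := hJ.integral_complex 0
  refine ⟨l, isIntegral_of_smul_toComplex hw'.1 fun i => ?_⟩
  have hMw : M.map (Int.cast : ℤ → ℂ) *ᵥ toComplex w =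
      (t * perronFrobenius B ^ l) • toComplex w' := by
    rw [pow_zero, Matrix.mul_one] at hM
    rw [hM, ← Matrix.mulVec_mulVec, h, Matrix.mulVec_smul, Matrix.pow_mulVec_eigenvector hw'.2,
      smul_smul]
  rw [← smul_eq_mul, ← Pi.smul_apply, ← hMw, ← one_mul ((_ *ᵥ _) i)]
  exact isIntegral_mulVec M (by simpa using isIntegral_toComplex w) i

theorem IsDimensionMap.exists_isIntegral_of_row (hJ : IsDimensionMap A B J)
    {v : Fin m → 𝓞 E} {v' : Fin n → 𝓞 E} (hv : IsNormalizedRow A v) (hv' : IsNormalizedRow B v')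
    {t : ℂ} (h : toComplex v' ᵥ* J.map (Rat.cast : ℚ → ℂ) = t • toComplex v) :
    ∃ l : ℕ, IsIntegral ℤ (t * perronFrobenius B ^ l) := by
  obtain ⟨l, M, hM⟩ := hJ.integral_complex 0
  refine ⟨l, isIntegral_of_smul_toComplex hv.1 fun i => ?_⟩
  have hvM : toComplex v' ᵥ* M.map (Int.cast : ℤ → ℂ) =
      (t * perronFrobenius B ^ l) • toComplex v := by
    rw [pow_zero, Matrix.mul_one] at hM
    rw [hM, ← Matrix.vecMul_vecMul, Matrix.vecMul_pow_eigenvector hv'.2, Matrix.smul_vecMul, h,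
      smul_smul, mul_comm]
  rw [← smul_eq_mul, ← Pi.smul_apply, ← hvM, ← Matrix.mulVec_transpose, ← one_mul ((_ *ᵥ _) i)]
  exact isIntegral_mulVec Mᵀ (by simpa using isIntegral_toComplex v') i

/-- Powers of `z'` may be replaced by powers of `z` if `z'` divides a power of `z`. -/
theorem IsIntegral.mul_pow_of_pow_div {t z z' : ℂ} (hz' : z' ≠ 0) {l s : ℕ}
    (h : IsIntegral ℤ (t * z' ^ l)) (hs : IsIntegral ℤ (z ^ s / z')) :
    IsIntegral ℤ (t * z ^ (s * l)) := by
  have : t * z ^ (s * l) = t * z' ^ l * (z ^ s / z') ^ l := by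
    rw [div_pow, pow_mul]
    field_simp
  rw [this]
  exact h.mul (hs.pow l)

theorem mem_adjoin_inv {t z : ℂ} (ht : t ∈ E) (hz : z ∈ E) (hz₀ : z ≠ 0) {l : ℕ}
    (h : IsIntegral ℤ (t * z ^ l)) : t ∈ Algebra.adjoin (𝓞 E) {z⁻¹} := by
  obtain ⟨a, ha⟩ := exists_ringOfIntegers_eq (mul_mem ht (pow_mem hz l)) h
  have : t = algebraMap (𝓞 E) ℂ a * z⁻¹ ^ l := by
    rw [ha, inv_pow, mul_inv_cancel_right₀ (pow_ne_zero l hz₀)]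
  rw [this]
  exact mul_mem (Subalgebra.algebraMap_mem _ a)
    (pow_mem (Algebra.self_mem_adjoin_singleton (𝓞 E) z⁻¹) l)

end Eigenvectors

/-! ### Existence of normalized eigenvectors, and units of `𝓞_E[1/λ]`. -/

section NormalizedVectors

variable {N : ℕ} {A : Matrix (Fin N) (Fin N) ℤ} {F E : IntermediateField ℚ ℂ}

theorem numberField_of_le [NumberField E] (h : F ≤ E) : NumberField F where
  to_finiteDimensional :=
    FiniteDimensional.of_injective (IntermediateField.inclusion h).toLinearMap
      (IntermediateField.inclusion_injective h)

theorem exists_isNormalizedColumn [NumberField F] (hFE : F ≤ E) (hE : IdealsBecomePrincipal hFE)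
    (hN : 0 < N) (hA : A.IsPrimitive) (hF : perronFrobenius A ∈ F) :
    ∃ w : Fin N → 𝓞 E, IsNormalizedColumn A w := by
  obtain ⟨x, hx₀, hxF, hx⟩ := exists_eigenvector_mem hF
    (perronFrobenius_mem_complexEigenvalues hN hA)
  obtain ⟨t, w, hw, h⟩ := exists_normalized_smul hFE hE hx₀ hxF
  exact ⟨w, hw, by rw [h, Matrix.mulVec_smul, hx, smul_comm]⟩

theorem exists_isNormalizedRow [NumberField F] (hFE : F ≤ E) (hE : IdealsBecomePrincipal hFE)
    (hN : 0 < N) (hA : A.IsPrimitive) (hF : perronFrobenius A ∈ F) :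
    ∃ v : Fin N → 𝓞 E, IsNormalizedRow A v := by
  obtain ⟨x, hx₀, hxF, hx⟩ := exists_row_eigenvector_mem hF
    (perronFrobenius_mem_complexEigenvalues hN hA)
  obtain ⟨t, v, hv, h⟩ := exists_normalized_smul hFE hE hx₀ hxF
  exact ⟨v, hv, by rw [h, Matrix.smul_vecMul, hx, smul_comm]⟩

/-- Two numbers of `E` which, together with their inverses, become integral after multiplication
by powers of `z` have a unit of `𝓞_E[1/z]` as their quotient. -/
theorem exists_unit_eq_div {c ξ : E} (hc : c ≠ 0) (hξ : ξ ≠ 0) {z : ℂ} (hz : z ∈ E) (hz₀ : z ≠ 0)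
    {k₁ k₂ k₃ k₄ : ℕ} (h₁ : IsIntegral ℤ ((c : ℂ) * z ^ k₁))
    (h₂ : IsIntegral ℤ ((c : ℂ)⁻¹ * z ^ k₂)) (h₃ : IsIntegral ℤ ((ξ : ℂ) * z ^ k₃))
    (h₄ : IsIntegral ℤ ((ξ : ℂ)⁻¹ * z ^ k₄)) :
    ∃ u : (Algebra.adjoin (𝓞 E) {z⁻¹})ˣ,
      ((u : Algebra.adjoin (𝓞 E) {z⁻¹}) : ℂ) = (ξ : ℂ) / c := by
  have hcC : (c : ℂ) ≠ 0 := by simpa using hc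
  have hξC : (ξ : ℂ) ≠ 0 := by simpa using hξ
  refine ⟨⟨⟨ξ * (c : ℂ)⁻¹, mul_mem (mem_adjoin_inv ξ.2 hz hz₀ h₃)
      (mem_adjoin_inv (inv_mem c.2) hz hz₀ h₂)⟩,
    ⟨c * (ξ : ℂ)⁻¹, mul_mem (mem_adjoin_inv c.2 hz hz₀ h₁)
      (mem_adjoin_inv (inv_mem ξ.2) hz hz₀ h₄)⟩, ?_, ?_⟩, (div_eq_mul_inv _ _).symm⟩
  all_goals
    apply Subtype.ext
    change _ * _ * (_ * _) = (1 : ℂ)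
    field_simp

end NormalizedVectors

/-! ### The proposition. -/

theorem proposition6p1 {m n : ℕ} (hm : 0 < m) (hn : 0 < n)
    (A : Matrix (Fin m) (Fin m) ℤ) (B : Matrix (Fin n) (Fin n) ℤ)
    (hA : A.IsPrimitive) (hB : B.IsPrimitive) (hA₀ : A.det ≠ 0) (hB₀ : B.det ≠ 0)
    (E : IntermediateField ℚ ℂ) [NumberField E] (hFE : eigenvalueField A B ≤ E)
    (hE : IdealsBecomePrincipal hFE)
    (θ : OrderedDimensionGroupIso A B) :
    -- normalized Perron–Frobenius eigenvectors exist over the integers of `E`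
    (∃ v : Fin m → 𝓞 E, IsNormalizedRow A v) ∧ (∃ w : Fin m → 𝓞 E, IsNormalizedColumn A w) ∧
    (∃ v' : Fin n → 𝓞 E, IsNormalizedRow B v') ∧
    (∃ w' : Fin n → 𝓞 E, IsNormalizedColumn B w') ∧
    -- the Perron–Frobenius eigenvalues generate the same field and involve the same primes of it
    ℚ⟮perronFrobenius A⟯ = ℚ⟮perronFrobenius B⟯ ∧
    (∀ p : HeightOneSpectrum (𝓞 ℚ⟮perronFrobenius A⟯),
      PrimeDivides p (perronFrobenius A) ↔ PrimeDivides p (perronFrobenius B)) ∧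
    -- the sizes agree and the isomorphism is given by a rational matrix `J`
    ∃ (hmn : m = n) (J : Matrix (Fin n) (Fin m) ℚ),
      (∀ g : dimensionGroup A,
        (θ.toAddEquiv g : Fin n → ℚ) = J *ᵥ (g : Fin m → ℚ)) ∧
      ∀ (v w : Fin m → 𝓞 E) (v' w' : Fin n → 𝓞 E),
        IsNormalizedRow A v → IsNormalizedColumn A w →
        IsNormalizedRow B v' → IsNormalizedColumn B w' →
        ∃ c : E, c ≠ 0 ∧
          toComplex v' ᵥ* J.map (Rat.cast : ℚ → ℂ) = (c : ℂ) • toComplex v ∧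
          (PrimesSeparate E A (perronFrobenius A) → PrimesSeparate E B (perronFrobenius A) →
            ∃ ξ : E, ξ ≠ 0 ∧
              J.map (Rat.cast : ℚ → ℂ) *ᵥ toComplex w = (ξ : ℂ) • toComplex w' ∧
              FactorsIntoPrimesOf ξ (perronFrobenius A) ∧
              FactorsIntoPrimesOf c (perronFrobenius A) ∧
              -- `v'Jw = c⟨v, w⟩ = ξ⟨v', w'⟩`
              toComplex v' ⬝ᵥ (J.map (Rat.cast : ℚ → ℂ) *ᵥ toComplex w)
                = (c : ℂ) * (toComplex v ⬝ᵥ toComplex w) ∧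
              (c : ℂ) * (toComplex v ⬝ᵥ toComplex w)
                = (ξ : ℂ) * (toComplex v' ⬝ᵥ toComplex w') ∧
              -- `v'Jw' = c⟨v, w'⟩ = (c/ξ) vJw`, the index sets being identified by `m = n`
              toComplex v' ⬝ᵥ (J.map (Rat.cast : ℚ → ℂ) *ᵥ (toComplex w' ∘ Fin.cast hmn))
                = (c : ℂ) * (toComplex v ⬝ᵥ (toComplex w' ∘ Fin.cast hmn)) ∧
              (c : ℂ) * (toComplex v ⬝ᵥ (toComplex w' ∘ Fin.cast hmn))
                = ((c : ℂ) / (ξ : ℂ)) * ((toComplex v ∘ Fin.cast hmn.symm) ⬝ᵥ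
                    (J.map (Rat.cast : ℚ → ℂ) *ᵥ toComplex w)) ∧
              -- `⟨v, w⟩` and `⟨v', w'⟩` agree up to a unit of the ring `𝓞_E[1/λ]`
              ∃ u : (Algebra.adjoin (𝓞 E) {(perronFrobenius A)⁻¹})ˣ,
                toComplex v ⬝ᵥ toComplex w
                  = ((u : Algebra.adjoin (𝓞 E) {(perronFrobenius A)⁻¹}) : ℂ)
                    * (toComplex v' ⬝ᵥ toComplex w')) := by
  set F := eigenvalueField A B with hF
  have hAF : ∀ μ ∈ complexEigenvalues A, μ ∈ F := fun μ hμ =>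
    IntermediateField.subset_adjoin ℚ _ (Or.inl hμ)
  have hBF : ∀ μ ∈ complexEigenvalues B, μ ∈ F := fun μ hμ =>
    IntermediateField.subset_adjoin ℚ _ (Or.inr hμ)
  have hpA := perronFrobenius_mem_complexEigenvalues hm hA
  have hpB := perronFrobenius_mem_complexEigenvalues hn hB
  have hpA₀ := perronFrobenius_ne_zero hm hA
  have hpB₀ := perronFrobenius_ne_zero hn hB
  have hpAi := isIntegral_of_mem_complexEigenvalues hpA
  have hpBi := isIntegral_of_mem_complexEigenvalues hpB
  have hpAE := hFE (hAF _ hpA)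
  have : NumberField F := numberField_of_le hFE
  have : NumberField ℚ⟮perronFrobenius A⟯ :=
    numberField_of_le (IntermediateField.adjoin_simple_le_iff.mpr hpAE)
  obtain ⟨J, J', hJJ', hJ'J, hθ, hJ, hJ'⟩ := θ.exists_matrix hm hn hA hB hA₀ hB₀
  obtain ⟨s, hs⟩ := hJ.exists_isIntegral_pow_div hm hn hA hB hA₀ hJ' hJJ'
  obtain ⟨s', hs'⟩ := hJ'.exists_isIntegral_pow_div hn hm hB hA hB₀ hJ hJ'J
  have hBA : perronFrobenius B ∈ ℚ⟮perronFrobenius A⟯ := hJ'.perronFrobenius_mem hm hA hJ'J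
  have hAB : perronFrobenius A ∈ ℚ⟮perronFrobenius B⟯ := hJ.perronFrobenius_mem hn hB hJJ'
  have hAA := IntermediateField.mem_adjoin_simple_self ℚ (perronFrobenius A)
  have hmn : m = n := by simpa using Matrix.square_of_invertible J' J hJ'J hJJ'
  refine ⟨exists_isNormalizedRow hFE hE hm hA (hAF _ hpA),
    exists_isNormalizedColumn hFE hE hm hA (hAF _ hpA),
    exists_isNormalizedRow hFE hE hn hB (hBF _ hpB),
    exists_isNormalizedColumn hFE hE hn hB (hBF _ hpB),
    le_antisymm (IntermediateField.adjoin_simple_le_iff.mpr hAB)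
      (IntermediateField.adjoin_simple_le_iff.mpr hBA),
    fun p => ⟨.of_isIntegral_div hpA₀ hBA hpBi hs, .of_isIntegral_div hpB₀ hAA hpAi hs'⟩,
    hmn, J, hθ, fun v w v' w' hv hw hv' hw' => ?_⟩
  have hv₀ := toComplex_ne_zero hv.1
  have hw'₀ := toComplex_ne_zero hw'.1
  obtain ⟨c, hc⟩ := perron_row_unique hm hA (hJ.row _ hv'.2) hv.2 hv₀
  have hcE : c ∈ E := mem_of_smul_mem hv₀ (toComplex_mem v) fun i => by
    rw [← hc]
    exact vecMul_ratCast_mem (toComplex_mem v') J i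
  have hc₀ : c ≠ 0 := by
    rintro rfl
    exact vecMul_ratCast_ne_zero hJJ' (toComplex_ne_zero hv'.1) (hc.trans (zero_smul _ _))
  refine ⟨⟨c, hcE⟩, fun h => hc₀ (congrArg Subtype.val h), hc, fun _ hsepB => ?_⟩
  have hcol := (hJ.isInfinitelyDivisible hpA₀ hw).mulVec_eq hn hB hB₀ hpA₀
    (fun μ hμ => hFE (hBF μ hμ)) hsepB
  obtain ⟨ξ, hξ⟩ := perron_column_unique hn hB hcol hw'.2 hw'₀
  have hξE : ξ ∈ E := mem_of_smul_mem hw'₀ (toComplex_mem w') fun i => by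
    rw [← hξ]
    exact mulVec_ratCast_mem (toComplex_mem w) J i
  have hJw : J'.map (Rat.cast : ℚ → ℂ) *ᵥ (ξ • toComplex w') = toComplex w := by
    rw [← hξ, Matrix.mulVec_mulVec, ratCast_map_mul_eq_one hJ'J, Matrix.one_mulVec]
  have hvJ : (c • toComplex v) ᵥ* J'.map (Rat.cast : ℚ → ℂ) = toComplex v' := by
    rw [← hc, Matrix.vecMul_vecMul, ratCast_map_mul_eq_one hJJ', Matrix.vecMul_one]
  have hξ₀ : ξ ≠ 0 := by
    rintro rfl
    rw [zero_smul, Matrix.mulVec_zero] at hJw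
    exact toComplex_ne_zero hw.1 hJw.symm
  have hJw' : J'.map (Rat.cast : ℚ → ℂ) *ᵥ toComplex w' = ξ⁻¹ • toComplex w := by
    rw [← hJw, Matrix.mulVec_smul, smul_smul, inv_mul_cancel₀ hξ₀, one_smul]
  have hvJ' : toComplex v ᵥ* J'.map (Rat.cast : ℚ → ℂ) = c⁻¹ • toComplex v' := by
    rw [← hvJ, Matrix.smul_vecMul, smul_smul, inv_mul_cancel₀ hc₀, one_smul]
  obtain ⟨k₁, h₁⟩ := hJ.exists_isIntegral_of_row hv hv' hc
  obtain ⟨k₂, h₂⟩ := hJ'.exists_isIntegral_of_row hv' hv hvJ'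
  obtain ⟨k₃, h₃⟩ := hJ.exists_isIntegral_of_column hw' hξ
  obtain ⟨k₄, h₄⟩ := hJ'.exists_isIntegral_of_column hw hJw'
  -- The bounds obtained from `J` involve powers of `λ'`; since `λ'` divides a power of `λ`, they
  -- become powers of `λ`, as in the bounds from `J'`.
  replace h₁ := h₁.mul_pow_of_pow_div hpB₀ hs'
  replace h₃ := h₃.mul_pow_of_pow_div hpB₀ hs'
  have hcE₀ : (⟨c, hcE⟩ : E) ≠ 0 := fun h => hc₀ (congrArg Subtype.val h)
  have hξE₀ : (⟨ξ, hξE⟩ : E) ≠ 0 := fun h => hξ₀ (congrArg Subtype.val h)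
  have hleft : ∀ x : Fin m → ℂ, toComplex v' ⬝ᵥ (J.map (Rat.cast : ℚ → ℂ) *ᵥ x) =
      c * (toComplex v ⬝ᵥ x) := fun x => by
    rw [Matrix.dotProduct_mulVec, hc, smul_dotProduct, smul_eq_mul]
  have hinner : c * (toComplex v ⬝ᵥ toComplex w) = ξ * (toComplex v' ⬝ᵥ toComplex w') := by
    rw [← hleft, hξ, dotProduct_smul, smul_eq_mul]
  refine ⟨⟨ξ, hξE⟩, hξE₀, hξ, factorsIntoPrimesOf_of_isIntegral hξE₀ hpAE hpA₀ hpAi h₃ h₄,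
    factorsIntoPrimesOf_of_isIntegral hcE₀ hpAE hpA₀ hpAi h₁ h₂, hleft _, hinner, hleft _, ?_, ?_⟩
  · subst hmn
    rw [hξ, dotProduct_smul, smul_eq_mul, ← mul_assoc, div_mul_cancel₀ _ hξ₀]
    rfl
  · obtain ⟨u, hu⟩ := exists_unit_eq_div hcE₀ hξE₀ hpAE hpA₀ h₁ h₂ h₃ h₄
    refine ⟨u, ?_⟩
    rw [hu]
    dsimp only
    rw [div_mul_eq_mul_div, ← hinner, mul_div_cancel_left₀ _ hc₀]
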